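/- **Theorem 4.5 (Evolution variational inequality).** Let $(X,d)$ be a complete metric space, $\lambda\in\mathbb R$, and let $\phi:X\to(-\infty,\infty]$ be lower semicontinuous with $D(\phi):=\{\phi<\infty\}\neq\emptyset$. A *minimal geodesic* from $x$ to $y$ is a curve $\gamma:[0,1]\to X$ with $\gamma(0)=x$, $\gamma(1)=y$ and $d(\gamma(s),\gamma(t))=|s-t|\,d(x,y)$ for all $s,t\in[0,1]$. For $\kappa\in\mathbb R$, a function $f:X\to(-\infty,\infty]$ is *$\kappa$-convex along $\gamma$* if, for all $t\in[0,1]$, $$f(\gamma(t))\le(1-t)f(\gamma(0))+tf(\gamma(1))-\tfrac{\kappa}{2}(1-t)t\,d^2(\gamma(0),\gamma(1)).$$ For $\tau>0$ and $x\in X$ put $\phi_\tau(x)=\inf_{z\in X}\{\phi(z)+d^2(x,z)/(2\tau)\}$, and let $J_\tau^\phi(x)$ be the set of points $z$ attaining this infimum. Assume one of the following. * **Case I.** $X$ is a CAT(1)-space (a geodesic space in which every geodesic triangle of perimeter less than $2\pi$ is at most as thick as its comparison triangle in the unit sphere $\mathbb S^2$) with $\operatorname{diam}X<\pi/2$, and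 any two points of $D(\phi)$ are joined by some minimal geodesic along which $\phi$ is $\lambda$-convex. * **Case II.** $\phi$ is coercive: there is $\tau_*>0$ such that $\phi_\tau(x)>-\infty$ and $J^\phi_\tau(x)\ne\emptyset$ for all $x\in X$ and $\tau\in(0,\tau_*)$. Moreover, there are $K\in\mathbb R$ and a family $\Gamma$ of minimal geodesics with endpoints in $D(\phi)$, joining any two points of $D(\phi)$, such that $\phi$ is $\lambda$-convex and, for every $z\in D(\phi)$, $d^2(z,\cdot)$ is $K$-convex along every $\gamma\in\Gamma$, and such that for all $\gamma,\eta\in\Gamma$ with $\gamma(0)=\eta(0)$ the following limits exist and are equal (commutativity): $$\lim_{s\downarrow0}\frac{d^2(\gamma(s),\eta(1))-d^2(\gamma(0),\eta(1))}{s}=\lim_{t\downarrow0}\frac{d^2(\eta(t),\gamma(1))-d^2(\eta(0),\gamma(1))}{t}.$$ Given $x_0\in D(\phi)$ and a partition $0=t^0<t^1<\cdots\to\infty$ of mesh $\sup_k(t^k-t^{k-1})$, a *discrete solution* from $x_0$ is a sequence $(x^k)_{k\ge0}$ with $x^0=x_0$ and $x^k\in J^\phi_{t^k-t^{k-1}}(x^{k-1})$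 for $k\ge1$. Its interpolation is the curve with value $x_0$ at $t=0$ and $x^k$ for $t\in(t^{k-1},t^k]$. Let $x_0\in D(\phi)$. Then all partitions of sufficiently small mesh admit a discrete solution from $x_0$, and there is a curve $\xi=\mathcal G(\cdot,x_0):[0,\infty)\to D(\phi)$ to which, for every sequence of partitions with mesh tending to $0$ and all associated discrete solutions from $x_0$, the interpolations converge uniformly on every bounded interval $[0,T]$. This (unique) curve satisfies $$\limsup_{\varepsilon\downarrow0}\frac{d^2(\xi(t+\varepsilon),y)-d^2(\xi(t),y)}{2\varepsilon}+\frac\lambda2d^2(\xi(t),y)+\phi(\xi(t))\le\phi(y)$$ for all $y\in D(\phi)$ and all $t>0$. In particular, for every $y\in D(\phi)$ and almost every $t>0$, the function $d^2(\xi(\cdot),y)$ is differentiable at $t$ and $$\frac12\frac{d}{dt}\big[d^2(\xi(t),y)\big]+\frac\lambda2d^2(\xi(t),y)+\phi(\xi(t))\le\phi(y).$$ -/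

import Mathlib

open Set Filter Topology MeasureTheory

noncomputable section

namespace EVIFlow

/-- `γ`, restricted to `[0,1]`, is a minimal geodesic of constant speed from `x` to `y` for the
distance function `δ` (values of `γ` outside `[0,1]` play no role). -/
def IsMinimalGeodesic {S : Type*} (δ : S → S → ℝ) (γ : ℝ → S) (x y : S) : Prop :=
  γ 0 = x ∧ γ 1 = y ∧
    ∀ s ∈ Icc (0 : ℝ) 1, ∀ t ∈ Icc (0 : ℝ) 1, δ (γ s) (γ t) = |s - t| * δ x y

/-- Any two points are joined by a minimal geodesic. -/
def IsGeodesicSpace (X : Type*) [MetricSpace X] : Prop :=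
  ∀ x y : X, ∃ γ : ℝ → X, IsMinimalGeodesic dist γ x y

/-- The unit sphere of Euclidean three-space. -/
abbrev UnitSphere : Type := Metric.sphere (0 : EuclideanSpace ℝ (Fin 3)) 1

/-- The intrinsic (angular) distance of the unit sphere. -/
def sphereDist (u v : UnitSphere) : ℝ :=
  InnerProductGeometry.angle (u : EuclideanSpace ℝ (Fin 3)) (v : EuclideanSpace ℝ (Fin 3))

/-- CAT(1)-spaces: geodesic triangles of perimeter less than `2π` are not thicker than their
comparison triangles in the unit sphere. -/
def IsCAT1 (X : Type*) [MetricSpace X] : Prop :=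
  IsGeodesicSpace X ∧
    ∀ x y z : X, dist x y + dist y z + dist z x < 2 * Real.pi →
      ∀ γ : ℝ → X, IsMinimalGeodesic dist γ y z →
        ∀ x' y' z' : UnitSphere,
          sphereDist x' y' = dist x y → sphereDist y' z' = dist y z →
          sphereDist z' x' = dist z x →
            ∀ γ' : ℝ → UnitSphere, IsMinimalGeodesic sphereDist γ' y' z' →
              ∀ t ∈ Icc (0 : ℝ) 1, dist x (γ t) ≤ sphereDist x' (γ' t)

section Potential

variable {X : Type*} [MetricSpace X]

/-- The proper domain `D(φ)` of `φ : X → (-∞, ∞]`. -/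
def domain (φ : X → EReal) : Set X := {x | φ x ≠ ⊤}

/-- The `κ`-convexity inequality of `f` along the curve `γ : [0,1] → X`. -/
def ConvexAlong (κ : ℝ) (f : X → EReal) (γ : ℝ → X) : Prop :=
  ∀ t ∈ Icc (0 : ℝ) 1,
    f (γ t) ≤ ((1 - t : ℝ) : EReal) * f (γ 0) + ((t : ℝ) : EReal) * f (γ 1)
      - ((κ / 2 * (1 - t) * t * dist (γ 0) (γ 1) ^ 2 : ℝ) : EReal)

/-- `φ` is `lam`-convex: any two points of `D(φ)` are joined by some minimal geodesic along which
the `lam`-convexity inequality holds. -/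
def IsLambdaConvex (lam : ℝ) (φ : X → EReal) : Prop :=
  ∀ x ∈ domain φ, ∀ y ∈ domain φ,
    ∃ γ : ℝ → X, IsMinimalGeodesic dist γ x y ∧ ConvexAlong lam φ γ

/-- The commutativity of two curves `γ, η` with a common origin: both one-sided derivatives
exist and they coincide. -/
def SqDistCommute (γ η : ℝ → X) : Prop :=
  ∃ L : ℝ,
    Tendsto (fun s : ℝ => (dist (γ s) (η 1) ^ 2 - dist (γ 0) (η 1) ^ 2) / s) (𝓝[>] 0) (𝓝 L) ∧
    Tendsto (fun s : ℝ => (dist (η s) (γ 1) ^ 2 - dist (η 0) (γ 1) ^ 2) / s) (𝓝[>] 0) (𝓝 L)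

/-- `Γ` is a family of minimal geodesics between points of `D(φ)`, joining any two of them, along
which `φ` is `lam`-convex, the squared distance functions `d²(z, ·)` are `K`-convex, and the
commutativity holds. -/
structure IsAdmissibleFamily (lam K : ℝ) (φ : X → EReal) (Γ : Set (ℝ → X)) : Prop where
  geodesic : ∀ γ ∈ Γ, γ 0 ∈ domain φ ∧ γ 1 ∈ domain φ ∧ IsMinimalGeodesic dist γ (γ 0) (γ 1)
  joins : ∀ x ∈ domain φ, ∀ y ∈ domain φ, ∃ γ ∈ Γ, γ 0 = x ∧ γ 1 = y
  potential_convex : ∀ γ ∈ Γ, ConvexAlong lam φ γ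
  sq_dist_convex : ∀ γ ∈ Γ, ∀ z ∈ domain φ,
    ConvexAlong K (fun w => ((dist z w ^ 2 : ℝ) : EReal)) γ
  commutativity : ∀ γ ∈ Γ, ∀ η ∈ Γ, γ 0 = η 0 → SqDistCommute γ η

/-- The Moreau–Yosida approximation `φ_τ`. -/
def moreauYosida (φ : X → EReal) (τ : ℝ) (x : X) : EReal :=
  ⨅ z : X, φ z + ((dist x z ^ 2 / (2 * τ) : ℝ) : EReal)

/-- The set `J_τ^φ(x)` of minimizers in the Moreau–Yosida approximation. -/
def minimizerSet (φ : X → EReal) (τ : ℝ) (x : X) : Set X :=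
  {z | φ z + ((dist x z ^ 2 / (2 * τ) : ℝ) : EReal) = moreauYosida φ τ x}

/-- Coercivity of `φ`. -/
def IsCoercive (φ : X → EReal) : Prop :=
  ∃ τs : ℝ, 0 < τs ∧ ∀ (x : X) (τ : ℝ), 0 < τ → τ < τs →
    ⊥ < moreauYosida φ τ x ∧ (minimizerSet φ τ x).Nonempty

/-- Partitions `0 = t⁰ < t¹ < ⋯ → ∞` of `[0, ∞)`. -/
structure TimePartition where
  pt : ℕ → ℝ
  pt_zero : pt 0 = 0
  strictMono : StrictMono pt
  unbounded : Tendsto pt atTop atTop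

/-- The mesh `|τ| = sup_k (t^k - t^{k-1}) ∈ [0, ∞]`. -/
def TimePartition.mesh (P : TimePartition) : ENNReal :=
  ⨆ k : ℕ, ENNReal.ofReal (P.pt (k + 1) - P.pt k)

/-- `x` is a discrete solution of the variational scheme for `φ`, `P` starting at `x₀`. -/
def IsDiscreteSolution (φ : X → EReal) (P : TimePartition) (x₀ : X) (x : ℕ → X) : Prop :=
  x 0 = x₀ ∧ ∀ k : ℕ, x (k + 1) ∈ minimizerSet φ (P.pt (k + 1) - P.pt k) (x k)

/-- The piecewise constant interpolation: `x 0` at time `0`, and `x k` on `(t^{k-1}, t^k]`. -/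
def interpolate (P : TimePartition) (x : ℕ → X) (t : ℝ) : X :=
  x (sInf {k : ℕ | t ≤ P.pt k})

/-- `ξ` (on `[0, ∞)`) is the gradient curve of `φ` starting at `x₀`: all sufficiently fine
partitions admit a discrete solution starting at `x₀`, and, whenever the mesh tends to zero, the
interpolated discrete solutions converge to `ξ` uniformly on bounded intervals. -/
def IsGradientCurve (φ : X → EReal) (x₀ : X) (ξ : ℝ → X) : Prop :=
  (∃ δ : ℝ, 0 < δ ∧ ∀ P : TimePartition, P.mesh < ENNReal.ofReal δ →
    ∃ x : ℕ → X, IsDiscreteSolution φ P x₀ x) ∧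
  ∀ (P : ℕ → TimePartition) (x : ℕ → ℕ → X),
    Tendsto (fun i => (P i).mesh) atTop (𝓝 0) →
    (∀ i, IsDiscreteSolution φ (P i) x₀ (x i)) →
    ∀ T : ℝ, TendstoUniformlyOn (fun i t => interpolate (P i) (x i) t) ξ atTop (Icc 0 T)

open Classical in
/-- The gradient flow `𝒢(t, x₀)`: the value at time `t ≥ 0` of the gradient curve starting at
`x₀` (and the default value `x₀` if there is no gradient curve). -/
def gradientFlow (φ : X → EReal) (t : ℝ) (x₀ : X) : X :=
  if h : ∃ ξ : ℝ → X, IsGradientCurve φ x₀ ξ then h.choose t else x₀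

end Potential

end EVIFlow

end

/-! ### Minimality in real-valued form and the one-step inequality -/

namespace EVIFlow

variable {X : Type*} [MetricSpace X]

/-! Everything rests on a one-step inequality, `OneStepEVI`: if `z` minimizes `φ + d²(x,·)/(2τ)`,
then `(1 + λτ) d²(z,y) + 2τ(φ(z) - φ(y)) ≤ d²(x,y) + C d²(x,z)` for all `y ∈ D(φ)`. Moving `z`
towards `y` along a geodesic on which `φ` is convex, minimality bounds the slope of `φ` by the first
variation of `d²(x,·)` (`slope_le_of_mem_minimizerSet`). It remains to bound this variation by
`d²(x,y) - d²(z,y) + C d²(x,z)`. In Case II commutativity turns it into the variation of `d²(y,·)`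
along the short geodesic from `z` to `x`; in Case I the spherical law of cosines gives `C = 20`.

The error is harmless: minimality also gives `d²(x^{k-1},x^k) ≤ 2h(φ(x^{k-1}) - φ(x^k))` for steps
at most `h`, so the errors telescope to a quantity of order `h` once `φ` is bounded below along the
scheme (`exists_lower_bound_discreteSolution`).

For two discrete solutions, a weighted sum of their one-step inequalities eliminates the potential
and leaves a recursion in two indices. A Crandall–Liggett induction (`crandall_liggett`) bounds the
squared distance by a multiple of `√((t-s)² + 2hT) + h`. Hence interpolations are Cauchy uniformly
on bounded intervals, their limit does not depend on the partitions, and it is locally 1/2-Hölder.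

Summing the one-step inequality over a short interval `[t, t+ε]`, then letting the mesh tend to zero
and using lower semicontinuity of `φ` near `ξ(t)`, yields the limsup inequality. The same sum shows
that `d²(ξ(t),y)` minus a linear function is locally nonincreasing, so Lebesgue's theorem gives
differentiability almost everywhere.

Coercivity supplies minimizers in Case II; in Case I they come from uniform midpoint convexity of
`d²` (`exists_mem_minimizerSet`). -/

theorem mem_domain_of_mem_minimizerSet {φ : X → EReal} {τ : ℝ} {x z y : X}
    (hz : z ∈ minimizerSet φ τ x) (hy : y ∈ domain φ) : z ∈ domain φ := by
  have h1 : φ z + ((dist x z ^ 2 / (2 * τ) : ℝ) : EReal)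
      ≤ φ y + ((dist x y ^ 2 / (2 * τ) : ℝ) : EReal) := by
    have hz' : φ z + ((dist x z ^ 2 / (2 * τ) : ℝ) : EReal) = moreauYosida φ τ x := hz
    rw [hz']
    exact iInf_le _ y
  intro htop
  rw [htop, EReal.top_add_coe, top_le_iff] at h1
  exact EReal.add_ne_top hy (EReal.coe_ne_top _) h1

theorem toReal_le_of_mem_minimizerSet {φ : X → EReal} (hbot : ∀ x, φ x ≠ ⊥) {τ : ℝ} {x z y : X}
    (hz : z ∈ minimizerSet φ τ x) (hy : y ∈ domain φ) :
    (φ z).toReal + dist x z ^ 2 / (2 * τ) ≤ (φ y).toReal + dist x y ^ 2 / (2 * τ) := by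
  have hzd := mem_domain_of_mem_minimizerSet hz hy
  have h1 : φ z + ((dist x z ^ 2 / (2 * τ) : ℝ) : EReal)
      ≤ φ y + ((dist x y ^ 2 / (2 * τ) : ℝ) : EReal) := by
    have hz' : φ z + ((dist x z ^ 2 / (2 * τ) : ℝ) : EReal) = moreauYosida φ τ x := hz
    rw [hz']
    exact iInf_le _ y
  rw [← EReal.coe_toReal hzd (hbot z), ← EReal.coe_toReal hy (hbot y)] at h1
  exact_mod_cast h1

theorem mem_minimizerSet_of_toReal_le {φ : X → EReal} (hbot : ∀ x, φ x ≠ ⊥) {τ : ℝ} {x z : X}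
    (hz : z ∈ domain φ)
    (h : ∀ y ∈ domain φ,
      (φ z).toReal + dist x z ^ 2 / (2 * τ) ≤ (φ y).toReal + dist x y ^ 2 / (2 * τ)) :
    z ∈ minimizerSet φ τ x := by
  refine le_antisymm (le_iInf fun y => ?_) (iInf_le _ z)
  by_cases hy : y ∈ domain φ
  · rw [← EReal.coe_toReal hz (hbot z), ← EReal.coe_toReal hy (hbot y)]
    exact_mod_cast h y hy
  · have : φ y = ⊤ := by simpa [domain] using hy
    rw [this, EReal.top_add_coe]
    exact le_top

theorem ConvexAlong.real_le {κ : ℝ} {φ : X → EReal} {γ : ℝ → X} (hbot : ∀ x, φ x ≠ ⊥)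
    (h : ConvexAlong κ φ γ) (h0 : γ 0 ∈ domain φ) (h1 : γ 1 ∈ domain φ) {t : ℝ}
    (ht : t ∈ Icc (0 : ℝ) 1) :
    γ t ∈ domain φ ∧ (φ (γ t)).toReal ≤ (1 - t) * (φ (γ 0)).toReal + t * (φ (γ 1)).toReal
      - κ / 2 * (1 - t) * t * dist (γ 0) (γ 1) ^ 2 := by
  have h2 := h t ht
  rw [← EReal.coe_toReal h0 (hbot _), ← EReal.coe_toReal h1 (hbot _)] at h2
  rw [← EReal.coe_mul, ← EReal.coe_mul, ← EReal.coe_add, ← EReal.coe_sub] at h2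
  have h3 : γ t ∈ domain φ := fun htop => by
    rw [htop, top_le_iff] at h2
    exact EReal.coe_ne_top _ h2
  refine ⟨h3, ?_⟩
  rw [← EReal.coe_toReal h3 (hbot _)] at h2
  exact_mod_cast h2

/-- The one-step evolution variational inequality of the minimizing movement scheme, with an
error controlled by the squared step length. -/
def OneStepEVI (lam C : ℝ) (φ : X → EReal) : Prop :=
  ∀ x ∈ domain φ, ∀ τ : ℝ, 0 < τ → ∀ z ∈ minimizerSet φ τ x, ∀ y ∈ domain φ,
    dist z y ^ 2 + lam * τ * dist z y ^ 2 + 2 * τ * ((φ z).toReal - (φ y).toReal)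
      ≤ dist x y ^ 2 + C * dist x z ^ 2

/-- Minimality tested along a curve on which the potential is convex: the derivative of the
squared distance dominates the slope of the potential. -/
theorem slope_le_of_mem_minimizerSet {φ : X → EReal} (hbot : ∀ x, φ x ≠ ⊥) {lam τ V : ℝ}
    (hτ : 0 < τ) {x z y : X} (hz : z ∈ minimizerSet φ τ x) (hy : y ∈ domain φ) {γ : ℝ → X}
    (hγ0 : γ 0 = z) (hγ1 : γ 1 = y) (hconv : ConvexAlong lam φ γ)
    (hV : ∀ δ > 0, ∀ᶠ s in 𝓝[>] (0 : ℝ), (dist x (γ s) ^ 2 - dist x z ^ 2) / s ≤ V + δ) :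
    lam * τ * dist z y ^ 2 + 2 * τ * ((φ z).toReal - (φ y).toReal) ≤ V := by
  have hzd := mem_domain_of_mem_minimizerSet hz hy
  -- Only an upper bound up to `δ` on the quotients is assumed, since spherical comparison gives no
  -- limit along `γ`. So `δ` is fixed, `s ↓ 0` is taken in the convexity term, and `δ` is removed at
  -- the end.
  refine le_of_forall_pos_le_add fun δ hδ => ?_
  have hlim : Tendsto (fun s : ℝ => lam * τ * (1 - s) * dist z y ^ 2
      + 2 * τ * ((φ z).toReal - (φ y).toReal)) (𝓝[>] 0)
      (𝓝 (lam * τ * (1 - 0) * dist z y ^ 2 + 2 * τ * ((φ z).toReal - (φ y).toReal))) := by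
    refine Tendsto.mono_left ?_ nhdsWithin_le_nhds
    exact Continuous.tendsto (by fun_prop) 0
  rw [sub_zero, mul_one] at hlim
  refine le_of_tendsto hlim ?_
  filter_upwards [hV δ hδ, Ioo_mem_nhdsGT (zero_lt_one' ℝ)] with s hs hs01
  obtain ⟨hs0, hs1⟩ := hs01
  rw [div_le_iff₀ hs0] at hs
  obtain ⟨hd, hc⟩ := hconv.real_le hbot (hγ0 ▸ hzd) (hγ1 ▸ hy) ⟨hs0.le, hs1.le⟩
  rw [hγ0, hγ1] at hc
  have hm := toReal_le_of_mem_minimizerSet hbot hz hd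
  have h1 : (φ z).toReal * (2 * τ) + dist x z ^ 2
      ≤ (φ (γ s)).toReal * (2 * τ) + dist x (γ s) ^ 2 := by
    have := mul_le_mul_of_nonneg_right hm (by positivity : 0 ≤ 2 * τ)
    rwa [add_mul, add_mul, div_mul_cancel₀ _ (by positivity), div_mul_cancel₀ _ (by positivity)]
      at this
  have h2 := mul_le_mul_of_nonneg_right hc (by positivity : 0 ≤ 2 * τ)
  have h3 : s * (lam * τ * (1 - s) * dist z y ^ 2 + 2 * τ * ((φ z).toReal - (φ y).toReal))
      ≤ s * (V + δ) := by linarith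
  exact le_of_mul_le_mul_left h3 hs0

/-- The one-step inequality from commutativity and semi-convexity of the squared distance. -/
theorem IsAdmissibleFamily.oneStepEVI {lam K : ℝ} {φ : X → EReal} {Γ : Set (ℝ → X)}
    (hbot : ∀ x, φ x ≠ ⊥) (hΓ : IsAdmissibleFamily lam K φ Γ) :
    OneStepEVI lam (|K| / 2) φ := by
  intro x hx τ hτ z hz y hy
  have hzd := mem_domain_of_mem_minimizerSet hz hy
  obtain ⟨γ, hγ, hγ0, hγ1⟩ := hΓ.joins z hzd y hy
  obtain ⟨η, hη, hη0, hη1⟩ := hΓ.joins z hzd x hx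
  -- Convexity of `d²(x,·)` along `γ` would cost a multiple of `d²(z,y)`, which is not small.
  -- Commutativity moves the derivative to `η`, where `K`-convexity costs only `d²(z,x)`, the
  -- squared step length.
  obtain ⟨V, hV1, hV2⟩ := hΓ.commutativity γ hγ η hη (hγ0.trans hη0.symm)
  rw [hη1, hγ0] at hV1
  rw [hγ1, hη0] at hV2
  have hmain := slope_le_of_mem_minimizerSet hbot hτ hz hy hγ0 hγ1 (hΓ.potential_convex γ hγ)
    (V := V) (fun δ hδ => by
      filter_upwards [hV1.eventually_le_const (lt_add_of_pos_right V hδ)] with s hs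
      rwa [dist_comm x, dist_comm x])
  have hK := hΓ.sq_dist_convex η hη y hy
  have hVle : V ≤ dist x y ^ 2 - dist z y ^ 2 - K / 2 * dist z x ^ 2 := by
    have hlim : Tendsto (fun s : ℝ => dist x y ^ 2 - dist z y ^ 2 - K / 2 * (1 - s) * dist z x ^ 2)
        (𝓝[>] 0) (𝓝 (dist x y ^ 2 - dist z y ^ 2 - K / 2 * (1 - 0) * dist z x ^ 2)) := by
      refine Tendsto.mono_left ?_ nhdsWithin_le_nhds
      exact Continuous.tendsto (by fun_prop) 0
    rw [sub_zero, mul_one] at hlim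
    refine le_of_tendsto_of_tendsto hV2 hlim ?_
    filter_upwards [Ioo_mem_nhdsGT (zero_lt_one' ℝ)] with s hs
    obtain ⟨-, hc⟩ := hK.real_le (fun _ => EReal.coe_ne_bot _) (EReal.coe_ne_top _)
      (EReal.coe_ne_top _) ⟨hs.1.le, hs.2.le⟩
    simp only [EReal.toReal_coe, hη0, hη1] at hc
    rw [div_le_iff₀ hs.1, dist_comm (η s), dist_comm z y, dist_comm x y]
    linarith
  have h4 : -(K / 2 * dist z x ^ 2) ≤ |K| / 2 * dist x z ^ 2 := by
    rw [dist_comm z x]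
    have := neg_abs_le K
    nlinarith [sq_nonneg (dist x z)]
  linarith

end EVIFlow

/-! ### Discrete Gronwall and Crandall–Liggett inequalities -/

namespace EVIFlow

/-- With `y = 2ατ` this is `exp(-2ατ) ≤ 1 - ατ`: the implicit factor `1 - ατ` of a recursion is
absorbed at the price of doubling the exponential rate. -/
theorem exp_neg_le_one_sub_half {y : ℝ} (h0 : 0 ≤ y) (h1 : y ≤ 1) :
    Real.exp (-y) ≤ 1 - y / 2 := by
  rw [Real.exp_neg]
  refine inv_le_of_inv_le₀ (by linarith) (le_trans ?_ (Real.add_one_le_exp y))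
  rw [inv_le_iff_one_le_mul₀ (by linarith)]
  nlinarith

/-- A discrete Gronwall inequality for non-uniform step sizes. -/
theorem discrete_gronwall {t c : ℕ → ℝ} {α β h : ℝ} {N : ℕ} (ht0 : t 0 = 0) (hα : 0 ≤ α)
    (hβ : 0 ≤ β) (hh : 2 * α * h ≤ 1) (hc0 : 0 ≤ c 0) (hstep : ∀ k, t k ≤ t (k + 1))
    (hmesh : ∀ k, t (k + 1) - t k ≤ h)
    (hrec : ∀ k < N, c (k + 1) ≤ c k + (t (k + 1) - t k) * (α * c (k + 1) + β)) :
    ∀ k ≤ N, c k ≤ Real.exp (2 * α * t k) * (c 0 + β * t k) := by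
  have htn : ∀ k, 0 ≤ t k := fun k => by
    induction k with
    | zero => exact ht0.ge
    | succ k ih => exact ih.trans (hstep k)
  intro k hk
  induction k with
  | zero => simp [ht0]
  | succ k ih =>
    have ih := ih (by omega)
    have hr := hrec k (by omega)
    set τ := t (k + 1) - t k with hτ
    have hτ0 : 0 ≤ τ := sub_nonneg.2 (hstep k)
    have hy : 2 * α * τ ≤ 1 :=
      (mul_le_mul_of_nonneg_left (hmesh k) (by positivity)).trans hh
    have he := exp_neg_le_one_sub_half (by positivity) hy
    have hE : Real.exp (2 * α * t k) = Real.exp (2 * α * t (k + 1)) * Real.exp (-(2 * α * τ)) := by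
      rw [← Real.exp_add]; congr 1; rw [hτ]; ring
    have hone : 1 ≤ Real.exp (2 * α * t k) :=
      Real.one_le_exp (by have := htn k; positivity)
    have hb : 0 ≤ c 0 + β * t (k + 1) := by have := htn (k + 1); positivity
    have h1 : (1 - α * τ) * c (k + 1)
        ≤ (1 - α * τ) * (Real.exp (2 * α * t (k + 1)) * (c 0 + β * t (k + 1))) := by
      calc (1 - α * τ) * c (k + 1) ≤ c k + τ * β := by linarith
        _ ≤ Real.exp (2 * α * t k) * (c 0 + β * t k) + Real.exp (2 * α * t k) * (τ * β) := by
            have : τ * β ≤ Real.exp (2 * α * t k) * (τ * β) :=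
              le_mul_of_one_le_left (by positivity) hone
            linarith
        _ = Real.exp (-(2 * α * τ)) * (Real.exp (2 * α * t (k + 1)) * (c 0 + β * t (k + 1))) := by
            rw [hE, hτ]; ring
        _ ≤ (1 - α * τ) * (Real.exp (2 * α * t (k + 1)) * (c 0 + β * t (k + 1))) := by
            refine mul_le_mul_of_nonneg_right (by linarith) (by positivity)
    exact le_of_mul_le_mul_left h1 (by linarith)

/-- Concavity of the square root, here through Cauchy–Schwarz. It transfers a supersolution property
from the radicand to its root. -/
theorem weighted_sqrt_le {σ τ p q r : ℝ} (hσ : 0 < σ) (hτ : 0 < τ) (hp : 0 ≤ p) (hq : 0 ≤ q)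
    (h : σ * p + τ * q ≤ (τ + σ) * r) :
    σ * √p + τ * √q ≤ (τ + σ) * √r := by
  have hr : 0 ≤ r := by
    by_contra hr
    have : (τ + σ) * r < 0 := mul_neg_of_pos_of_neg (by linarith) (not_le.1 hr)
    have : 0 ≤ σ * p + τ * q := by positivity
    linarith
  refine abs_le_of_sq_le_sq' ?_ (by positivity) |>.2
  have h1 := Real.sq_sqrt hp
  have h2 := Real.sq_sqrt hq
  have h3 := Real.sq_sqrt hr
  have h4 : (σ * √p + τ * √q) ^ 2 ≤ (τ + σ) * (σ * √p ^ 2 + τ * √q ^ 2) := by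
    have : 0 ≤ σ * τ * (√p - √q) ^ 2 := by positivity
    nlinarith
  rw [h1, h2] at h4
  rw [mul_pow, h3]
  calc _ ≤ _ := h4
    _ ≤ (τ + σ) * ((τ + σ) * r) := mul_le_mul_of_nonneg_left h (by positivity)
    _ = _ := by ring

/-- A Crandall–Liggett type double induction for two non-uniform grids `t`, `s` with mesh at most
`h`, with an exponential factor and error terms telescoping in each index. -/
theorem crandall_liggett {t s f g : ℕ → ℝ} {a : ℕ → ℕ → ℝ} {I J : ℕ} {h μ C c F : ℝ}
    (hμ : 0 ≤ μ) (hC : 0 ≤ C) (hc : 0 ≤ c) (hh : 4 * μ * h ≤ 1)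
    (ht0 : t 0 = 0) (hs0 : s 0 = 0) (ht : StrictMono t) (hs : StrictMono s)
    (htm : ∀ k, t (k + 1) - t k ≤ h) (hsm : ∀ k, s (k + 1) - s k ≤ h)
    (hf : Antitone f) (hg : Antitone g) (hf0 : f 0 ≤ F) (hg0 : g 0 ≤ F)
    (hrec : ∀ i < I, ∀ j < J,
      ((t (i + 1) - t i) + (s (j + 1) - s j)
          - 2 * μ * (t (i + 1) - t i) * (s (j + 1) - s j)) * a (i + 1) (j + 1)
        ≤ (s (j + 1) - s j) * a i (j + 1) + (t (i + 1) - t i) * a (i + 1) j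
          + 2 * C * (t (i + 1) - t i) * (s (j + 1) - s j)
            * ((f i - f (i + 1)) + (g j - g (j + 1))))
    (hI : ∀ i ≤ I, a i 0 ≤ c * t i) (hJ : ∀ j ≤ J, a 0 j ≤ c * s j) :
    ∀ i ≤ I, ∀ j ≤ J, a i j ≤ Real.exp (4 * μ * (t i + s j)) *
      (c * √((t i - s j) ^ 2 + h * (t i + s j)) + 2 * C * h * (2 * F - f i - g j)) := by
  have htn : ∀ k, 0 ≤ t k := fun k => ht0 ▸ ht.monotone (Nat.zero_le k)
  have hsn : ∀ k, 0 ≤ s k := fun k => hs0 ▸ hs.monotone (Nat.zero_le k)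
  have hh0 : 0 ≤ h := (sub_nonneg.2 (ht.monotone (Nat.le_succ 0))).trans (htm 0)
  have hfF : ∀ k, f k ≤ F := fun k => (hf (Nat.zero_le k)).trans hf0
  have hgF : ∀ k, g k ≤ F := fun k => (hg (Nat.zero_le k)).trans hg0
  have hQ : ∀ i j, 0 ≤ (t i - s j) ^ 2 + h * (t i + s j) := fun i j => by
    have := htn i; have := hsn j; positivity
  have hZ : ∀ i j, 0 ≤ c * √((t i - s j) ^ 2 + h * (t i + s j))
      + 2 * C * h * (2 * F - f i - g j) := fun i j => by
    have : 0 ≤ 2 * F - f i - g j := by linarith [hfF i, hgF j]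
    positivity
  have hbdry : ∀ i j, ∀ r : ℝ, 0 ≤ r → r ≤ |t i - s j| → c * r ≤
      Real.exp (4 * μ * (t i + s j)) *
      (c * √((t i - s j) ^ 2 + h * (t i + s j)) + 2 * C * h * (2 * F - f i - g j)) := by
    intro i j r hr hr'
    have hE : 1 ≤ Real.exp (4 * μ * (t i + s j)) :=
      Real.one_le_exp (by have := htn i; have := hsn j; positivity)
    refine le_trans ?_ (le_mul_of_one_le_left (hZ i j) hE)
    have h1 : r ≤ √((t i - s j) ^ 2 + h * (t i + s j)) := by
      refine hr'.trans (Real.abs_le_sqrt ?_)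
      have := htn i; have := hsn j
      have : 0 ≤ h * (t i + s j) := by positivity
      linarith
    have h2 : 0 ≤ 2 * C * h * (2 * F - f i - g j) := by
      have : 0 ≤ 2 * F - f i - g j := by linarith [hfF i, hgF j]
      positivity
    have := mul_le_mul_of_nonneg_left h1 hc
    linarith
  intro i
  induction i with
  | zero =>
    intro _ j hj
    exact (hJ j hj).trans (hbdry 0 j _ (hsn j) (by rw [ht0, zero_sub, abs_neg]; exact le_abs_self _))
  | succ i ihi =>
    intro hi j
    induction j with
    | zero =>
      intro _
      exact (hI _ hi).trans (hbdry _ 0 _ (htn _) (by rw [hs0, sub_zero]; exact le_abs_self _))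
    | succ j ihj =>
      intro hj
      have h1 := ihi (by omega) (j + 1) hj
      have h2 := ihj (by omega)
      have hr := hrec i (by omega) j (by omega)
      have hZ0 := hZ (i + 1) (j + 1)
      have hZ1 := hZ i (j + 1)
      have hZ2 := hZ (i + 1) j
      have hτ0 : 0 < t (i + 1) - t i := sub_pos.2 (ht (Nat.lt_succ_self i))
      have hσ0 : 0 < s (j + 1) - s j := sub_pos.2 (hs (Nat.lt_succ_self j))
      have hτh := htm i
      have hσh := hsm j
      have hΔf : 0 ≤ f i - f (i + 1) := sub_nonneg.2 (hf (Nat.le_succ i))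
      have hΔg : 0 ≤ g j - g (j + 1) := sub_nonneg.2 (hg (Nat.le_succ j))
      -- Write `τ, σ` for the two steps. In the weighted sum of the squares the terms linear in `t -
      -- s` cancel, leaving `τσ(τ + σ)`, which the term `h(t + s)` pays for with `2hτσ`.
      have hsq := weighted_sqrt_le (r := (t (i + 1) - s (j + 1)) ^ 2 + h * (t (i + 1) + s (j + 1)))
        hσ0 hτ0 (hQ i (j + 1)) (hQ (i + 1) j) (by
          have : 0 ≤ (t (i + 1) - t i) * (s (j + 1) - s j)
              * (2 * h - (t (i + 1) - t i) - (s (j + 1) - s j)) :=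
            mul_nonneg (by positivity) (by linarith)
          linarith)
      have hti := htn i
      have hsj := hsn j
      obtain ⟨τ, hτ⟩ : ∃ τ, τ = t (i + 1) - t i := ⟨_, rfl⟩
      obtain ⟨σ, hσ⟩ : ∃ σ, σ = s (j + 1) - s j := ⟨_, rfl⟩
      obtain ⟨E, hE⟩ : ∃ E, E = (f i - f (i + 1)) + (g j - g (j + 1)) := ⟨_, rfl⟩
      have hE0 : 0 ≤ E := by linarith
      obtain ⟨Z1, hZ1e⟩ : ∃ Z, Z = c * √((t i - s (j + 1)) ^ 2 + h * (t i + s (j + 1)))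
        + 2 * C * h * (2 * F - f i - g (j + 1)) := ⟨_, rfl⟩
      obtain ⟨Z2, hZ2e⟩ : ∃ Z, Z = c * √((t (i + 1) - s j) ^ 2 + h * (t (i + 1) + s j))
        + 2 * C * h * (2 * F - f (i + 1) - g j) := ⟨_, rfl⟩
      obtain ⟨Z0, hZ0e⟩ : ∃ Z, Z = c * √((t (i + 1) - s (j + 1)) ^ 2
        + h * (t (i + 1) + s (j + 1)))
        + 2 * C * h * (2 * F - f (i + 1) - g (j + 1)) := ⟨_, rfl⟩
      -- The bracket without exponential is a supersolution: its potential part gains `2Ch(σΔf +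
      -- τΔg)`, where `Δf, Δg` are the decrements of `f, g`, and this covers the source `2Cτσ(Δf +
      -- Δg)` because `τ, σ ≤ h`.
      have hsuper : σ * Z1 + τ * Z2 + 2 * C * τ * σ * E ≤ (τ + σ) * Z0 := by
        rw [← hτ, ← hσ] at hsq
        have hsq' := mul_le_mul_of_nonneg_left hsq hc
        have e1 : 0 ≤ 2 * C * σ * (f i - f (i + 1)) * (h - τ) :=
          mul_nonneg (mul_nonneg (mul_nonneg (by positivity) (by linarith)) hΔf) (by linarith)
        have e2 : 0 ≤ 2 * C * τ * (g j - g (j + 1)) * (h - σ) :=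
          mul_nonneg (mul_nonneg (mul_nonneg (by positivity) (by linarith)) hΔg) (by linarith)
        rw [hZ1e, hZ2e, hZ0e, hE]
        linarith
      rw [← hτ, ← hσ, ← hE] at hr
      rw [← hZ1e] at h1 hZ1
      rw [← hZ2e] at h2 hZ2
      rw [← hZ0e] at hZ0 ⊢
      rw [← hτ] at hτ0 hτh
      rw [← hσ] at hσ0 hσh
      obtain ⟨W, hW⟩ : ∃ W, W = Real.exp (4 * μ * (t (i + 1) + s (j + 1))) := ⟨_, rfl⟩
      have hW0 : 0 < W := hW ▸ Real.exp_pos _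
      rw [← hW]
      -- Both predecessors lie at least `m = min τ σ` earlier in `t + s`, so the exponential gains
      -- `e = exp(-4μm) ≤ 1 - 2μm`. Since `τσ ≤ m(τ + σ)`, this compensates the loss `2μτσ` on the
      -- left.
      have hm0 : 0 < min τ σ := lt_min hτ0 hσ0
      have hmτ := min_le_left τ σ
      have hmσ := min_le_right τ σ
      have hmul : 2 * (τ * σ) ≤ 2 * (min τ σ * (τ + σ)) := by
        rcases le_total τ σ with hle | hle
        · rw [min_eq_left hle]; have := sq_nonneg τ; linarith only [this]
        · rw [min_eq_right hle]; have := sq_nonneg σ; linarith only [this]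
      obtain ⟨m, hm⟩ : ∃ m, m = min τ σ := ⟨_, rfl⟩
      rw [← hm] at hm0 hmτ hmσ hmul
      have hy : 4 * μ * m ≤ 1 :=
        (mul_le_mul_of_nonneg_left (hmτ.trans hτh) (by positivity)).trans hh
      have hexp := exp_neg_le_one_sub_half (by positivity) hy
      obtain ⟨e, he⟩ : ∃ e, e = Real.exp (-(4 * μ * m)) := ⟨_, rfl⟩
      have he0 : 0 < e := he ▸ Real.exp_pos _
      rw [← he] at hexp
      have hE1 : Real.exp (4 * μ * (t i + s (j + 1))) ≤ W * e := by
        rw [hW, he, ← Real.exp_add]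
        refine Real.exp_le_exp.2 ?_
        have := mul_le_mul_of_nonneg_left hmτ hμ
        rw [hτ] at this
        linarith
      have hE2 : Real.exp (4 * μ * (t (i + 1) + s j)) ≤ W * e := by
        rw [hW, he, ← Real.exp_add]
        refine Real.exp_le_exp.2 ?_
        have := mul_le_mul_of_nonneg_left hmσ hμ
        rw [hσ] at this
        linarith
      have hE3 : 1 ≤ W * e := by
        refine le_trans (Real.one_le_exp ?_) hE1
        have := hsn (j + 1)
        positivity
      have g1 : a i (j + 1) ≤ W * e * Z1 := h1.trans (mul_le_mul_of_nonneg_right hE1 hZ1)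
      have g2 : a (i + 1) j ≤ W * e * Z2 := h2.trans (mul_le_mul_of_nonneg_right hE2 hZ2)
      have g3 : 2 * C * τ * σ * E ≤ W * e * (2 * C * τ * σ * E) :=
        le_mul_of_one_le_left (by positivity) hE3
      have key : (τ + σ - 2 * μ * τ * σ) * a (i + 1) (j + 1)
          ≤ (τ + σ - 2 * μ * τ * σ) * (W * Z0) := by
        calc _ ≤ _ := hr
          _ ≤ σ * (W * e * Z1) + τ * (W * e * Z2) + W * e * (2 * C * τ * σ * E) := by
              gcongr
          _ = W * e * (σ * Z1 + τ * Z2 + 2 * C * τ * σ * E) := by ring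
          _ ≤ W * e * ((τ + σ) * Z0) := mul_le_mul_of_nonneg_left hsuper (by positivity)
          _ = (e * (τ + σ)) * (W * Z0) := by ring
          _ ≤ _ := by
              refine mul_le_mul_of_nonneg_right ?_ (by positivity)
              have i1 := mul_le_mul_of_nonneg_right hexp (by linarith : 0 ≤ τ + σ)
              have i2 := mul_le_mul_of_nonneg_left hmul hμ
              linarith only [i1, i2]
      refine le_of_mul_le_mul_left key ?_
      have i2 := mul_le_mul_of_nonneg_left hmul hμ
      have i3 := mul_le_mul_of_nonneg_right hy (by linarith : 0 ≤ τ + σ)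
      nlinarith only [i2, i3, hτ0, hσ0]

end EVIFlow

/-! ### A priori estimates and comparison of discrete solutions -/

namespace EVIFlow

theorem TimePartition.pt_nonneg (P : TimePartition) (k : ℕ) : 0 ≤ P.pt k :=
  P.pt_zero ▸ P.strictMono.monotone (Nat.zero_le k)

theorem TimePartition.step_pos (P : TimePartition) (k : ℕ) : 0 < P.pt (k + 1) - P.pt k :=
  sub_pos.2 (P.strictMono (Nat.lt_succ_self k))

variable {X : Type*} [MetricSpace X] {φ : X → EReal} {P Q : TimePartition} {x₀ : X} {x y : ℕ → X}

namespace IsDiscreteSolution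

theorem mem_domain (hx : IsDiscreteSolution φ P x₀ x) (hx₀ : x₀ ∈ domain φ) (k : ℕ) :
    x k ∈ domain φ := by
  cases k with
  | zero => rw [hx.1]; exact hx₀
  | succ k => exact mem_domain_of_mem_minimizerSet (hx.2 k) hx₀

/-- Minimality tested against the previous point. -/
theorem dist_sq_step_le (hbot : ∀ x, φ x ≠ ⊥) (hx : IsDiscreteSolution φ P x₀ x)
    (hx₀ : x₀ ∈ domain φ) (k : ℕ) :
    dist (x k) (x (k + 1)) ^ 2
      ≤ 2 * (P.pt (k + 1) - P.pt k) * ((φ (x k)).toReal - (φ (x (k + 1))).toReal) := by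
  have h := toReal_le_of_mem_minimizerSet hbot (hx.2 k) (hx.mem_domain hx₀ k)
  have hτ := P.step_pos k
  rw [dist_self, zero_pow two_ne_zero, zero_div, add_zero, ← le_sub_iff_add_le',
    div_le_iff₀ (by positivity)] at h
  linarith

theorem antitone (hbot : ∀ x, φ x ≠ ⊥) (hx : IsDiscreteSolution φ P x₀ x)
    (hx₀ : x₀ ∈ domain φ) : Antitone fun k => (φ (x k)).toReal := by
  refine antitone_nat_of_succ_le fun k => ?_
  have h := (sq_nonneg _).trans (hx.dist_sq_step_le hbot hx₀ k)
  have hτ := P.step_pos k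
  exact sub_nonneg.1 (nonneg_of_mul_nonneg_right h (by positivity))

theorem toReal_le (hbot : ∀ x, φ x ≠ ⊥) (hx : IsDiscreteSolution φ P x₀ x)
    (hx₀ : x₀ ∈ domain φ) (k : ℕ) : (φ (x k)).toReal ≤ (φ x₀).toReal := by
  have := hx.antitone hbot hx₀ (Nat.zero_le k)
  simpa [hx.1] using this

/-- Cauchy–Schwarz for the sum of the step lengths, carried out by induction; the cross term of the
square is controlled by the arithmetic–geometric mean inequality. -/
theorem dist_sq_le (hbot : ∀ x, φ x ≠ ⊥) (hx : IsDiscreteSolution φ P x₀ x)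
    (hx₀ : x₀ ∈ domain φ) (k : ℕ) :
    dist x₀ (x k) ^ 2 ≤ 2 * ((φ x₀).toReal - (φ (x k)).toReal) * P.pt k := by
  induction k with
  | zero => simp [hx.1, P.pt_zero]
  | succ k ih =>
    have hstep := hx.dist_sq_step_le hbot hx₀ k
    have hle := hx.toReal_le hbot hx₀ k
    have hle' := hx.antitone hbot hx₀ (Nat.le_succ k)
    have htri := dist_triangle x₀ (x k) (x (k + 1))
    have hτ := P.step_pos k
    have ht := P.pt_nonneg k
    simp only at hle'
    obtain ⟨τ, hτe⟩ : ∃ τ, τ = P.pt (k + 1) - P.pt k := ⟨_, rfl⟩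
    obtain ⟨δ, hδ⟩ : ∃ δ, δ = (φ (x k)).toReal - (φ (x (k + 1))).toReal := ⟨_, rfl⟩
    obtain ⟨Δ, hΔ⟩ : ∃ Δ, Δ = (φ x₀).toReal - (φ (x k)).toReal := ⟨_, rfl⟩
    rw [← hτe] at hτ hstep
    rw [← hδ] at hstep
    rw [← hΔ] at ih
    have hδ0 : 0 ≤ δ := by linarith
    have hΔ0 : 0 ≤ Δ := by linarith
    have hcross : dist x₀ (x k) * dist (x k) (x (k + 1)) ≤ P.pt k * δ + τ * Δ := by
      refine (abs_le_of_sq_le_sq' ?_ (by positivity)).2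
      calc _ = dist x₀ (x k) ^ 2 * dist (x k) (x (k + 1)) ^ 2 := by ring
        _ ≤ (2 * Δ * P.pt k) * (2 * τ * δ) := by gcongr
        _ ≤ _ := by nlinarith only [sq_nonneg (P.pt k * δ - τ * Δ)]
    have hsq : dist x₀ (x (k + 1)) ^ 2 ≤ (dist x₀ (x k) + dist (x k) (x (k + 1))) ^ 2 := by gcongr
    have e1 : (φ x₀).toReal - (φ (x (k + 1))).toReal = Δ + δ := by rw [hΔ, hδ]; ring
    have e2 : P.pt (k + 1) = P.pt k + τ := by rw [hτe]; ring
    rw [e1, e2]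
    linarith

end IsDiscreteSolution

/-- Along discrete solutions of small mesh the potential is bounded below, uniformly on bounded
time intervals. -/
theorem exists_lower_bound_discreteSolution (hbot : ∀ x, φ x ≠ ⊥) (hx₀ : x₀ ∈ domain φ)
    {lam C A B : ℝ} (hC : 0 ≤ C) (hB : 0 ≤ B) (hevi : OneStepEVI lam C φ)
    (hlow : ∀ z ∈ domain φ, -A - B * dist x₀ z ^ 2 ≤ (φ z).toReal) {T : ℝ} :
    ∃ h₀ > 0, ∃ M : ℝ, ∀ (P : TimePartition) (x : ℕ → X), IsDiscreteSolution φ P x₀ x →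
      (∀ k, P.pt (k + 1) - P.pt k ≤ h₀) → ∀ k, P.pt k ≤ T → -M ≤ (φ (x k)).toReal := by
  set α := |lam| + 2 * B with hα
  have hα0 : 0 ≤ α := by positivity
  have hden : 0 < 4 * α + 4 * C * B + 1 := by positivity
  set h := 1 / (4 * α + 4 * C * B + 1) with hh
  have hh0 : 0 < h := by positivity
  -- This choice serves two purposes: `4αh ≤ 1` for Gronwall with rate `2α`, and `4CBh ≤ 1` so that
  -- the quadratic lower bound on `φ` can be absorbed into `d²`.
  have hh1 : h * (4 * α + 4 * C * B + 1) = 1 := one_div_mul_cancel hden.ne'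
  have hαh : 0 ≤ α * h := by positivity
  have hCBh : 0 ≤ C * B * h := by positivity
  set β := 2 * ((φ x₀).toReal + A) with hβ
  have hβ0 : 0 ≤ β := by
    have := hlow x₀ hx₀
    rw [dist_self] at this
    linarith
  set R := Real.exp (2 * (2 * α) * T) * (C * h * β + β * T) with hR
  refine ⟨h, hh0, A + B * (2 * R), fun P x hx hmesh => ?_⟩
  -- Adding `2Ch(φ + A)` to the squared distance absorbs the error `C d²(x^k, x^{k+1})`, which is at
  -- most `2Ch` times the drop of `φ`. The modified quantity still dominates half of the squared
  -- distance.
  set c : ℕ → ℝ := fun k => dist (x k) x₀ ^ 2 + 2 * C * h * ((φ (x k)).toReal + A) with hc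
  have hca : ∀ k, dist (x k) x₀ ^ 2 ≤ 2 * c k := by
    intro k
    have h1 := hlow _ (hx.mem_domain hx₀ k)
    rw [dist_comm] at h1
    have h2 := mul_le_mul_of_nonneg_left h1 (by positivity : 0 ≤ 4 * C * h)
    have h3 : (4 * C * B * h) * dist (x k) x₀ ^ 2 ≤ 1 * dist (x k) x₀ ^ 2 := by
      refine mul_le_mul_of_nonneg_right ?_ (sq_nonneg _)
      linarith
    simp only [hc]
    linarith
  have hc0 : c 0 = C * h * β := by
    simp only [hc, hx.1, dist_self, hβ]
    ring
  have hgron := fun N => discrete_gronwall (t := P.pt) (c := c) (α := 2 * α) (β := β) (h := h)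
    (N := N) P.pt_zero (by positivity) hβ0 (by linarith) (hc0 ▸ by positivity)
    (fun k => (P.strictMono (Nat.lt_succ_self k)).le) hmesh (by
      intro k _
      have hτ := P.step_pos k
      have hs := hx.dist_sq_step_le hbot hx₀ k
      have he := hevi _ (hx.mem_domain hx₀ k) _ hτ _ (hx.2 k) x₀ hx₀
      have hl := hlow _ (hx.mem_domain hx₀ (k + 1))
      have hmono := hx.antitone hbot hx₀ (Nat.le_succ k)
      have hm := hmesh k
      simp only at hmono
      have hd := hca (k + 1)
      rw [dist_comm x₀] at hl
      obtain ⟨τ, hτe⟩ : ∃ τ, τ = P.pt (k + 1) - P.pt k := ⟨_, rfl⟩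
      rw [← hτe] at hτ hs he hm ⊢
      have g1 : C * dist (x k) (x (k + 1)) ^ 2
          ≤ 2 * C * h * ((φ (x k)).toReal - (φ (x (k + 1))).toReal) := by
        have : 2 * τ * ((φ (x k)).toReal - (φ (x (k + 1))).toReal)
            ≤ 2 * h * ((φ (x k)).toReal - (φ (x (k + 1))).toReal) :=
          mul_le_mul_of_nonneg_right (by linarith) (by linarith)
        have := mul_le_mul_of_nonneg_left (hs.trans this) hC
        linarith
      have g2 : -lam * dist (x (k + 1)) x₀ ^ 2 ≤ |lam| * dist (x (k + 1)) x₀ ^ 2 :=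
        mul_le_mul_of_nonneg_right (neg_le_abs lam) (sq_nonneg _)
      have g3 : τ * (-lam * dist (x (k + 1)) x₀ ^ 2
            + 2 * ((φ x₀).toReal - (φ (x (k + 1))).toReal))
          ≤ τ * (2 * α * c (k + 1) + β) := by
        refine mul_le_mul_of_nonneg_left ?_ hτ.le
        have g4 := mul_le_mul_of_nonneg_left hd hα0
        rw [hβ]
        rw [hα] at g4 ⊢
        linarith
      simp only [hc] at g3 ⊢
      linarith)
  intro k hk
  have h1 := hgron k k le_rfl
  have hk0 := P.pt_nonneg k
  have h2 : c k ≤ R := by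
    refine h1.trans ?_
    rw [hc0, hR]
    gcongr
  have h3 := hlow _ (hx.mem_domain hx₀ k)
  have h4 := hca k
  rw [dist_comm] at h4
  have h5 := mul_le_mul_of_nonneg_left (h4.trans (by linarith : 2 * c k ≤ 2 * R)) hB
  linarith

/-- The basic comparison of two discrete solutions with the same starting point. -/
theorem exists_dist_sq_discreteSolution_le (hbot : ∀ x, φ x ≠ ⊥) (hx₀ : x₀ ∈ domain φ)
    {lam C A B : ℝ} (hC : 0 ≤ C) (hB : 0 ≤ B) (hevi : OneStepEVI lam C φ)
    (hlow : ∀ z ∈ domain φ, -A - B * dist x₀ z ^ 2 ≤ (φ z).toReal) {T : ℝ} :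
    ∃ h₀ > 0, ∃ G : ℝ, ∀ h ≤ h₀, ∀ (P Q : TimePartition) (x y : ℕ → X),
      IsDiscreteSolution φ P x₀ x → IsDiscreteSolution φ Q x₀ y →
      (∀ k, P.pt (k + 1) - P.pt k ≤ h) → (∀ k, Q.pt (k + 1) - Q.pt k ≤ h) →
      ∀ i j, P.pt i ≤ T → Q.pt j ≤ T →
        dist (x i) (y j) ^ 2 ≤ G * (√((P.pt i - Q.pt j) ^ 2 + 2 * h * T) + h) := by
  obtain ⟨h₁, hh₁, M, hM⟩ := exists_lower_bound_discreteSolution (T := T) hbot hx₀ hC hB hevi hlow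
  set μ := |lam| with hμ
  set F := (φ x₀).toReal with hF
  have hμ0 : 0 ≤ μ := abs_nonneg _
  refine ⟨min h₁ (1 / (4 * μ + 1)), by positivity,
    Real.exp (4 * μ * (T + T)) * (2 * (F + M) + 4 * C * (F + M)), ?_⟩
  intro h hh P Q x y hx hy hPm hQm i j hi hj
  have hhh₁ : h ≤ h₁ := hh.trans (min_le_left _ _)
  have hh2 : 4 * μ * h ≤ 1 := by
    have h1 : 4 * μ * h ≤ 4 * μ * (1 / (4 * μ + 1)) :=
      mul_le_mul_of_nonneg_left (hh.trans (min_le_right _ _)) (by positivity)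
    refine h1.trans ?_
    rw [mul_one_div, div_le_one (by positivity)]
    linarith
  have hh0 : 0 ≤ h := (P.step_pos 0).le.trans (hPm 0)
  have hxM : ∀ k, P.pt k ≤ T → -M ≤ (φ (x k)).toReal :=
    hM P x hx (fun k => (hPm k).trans hhh₁)
  have hyM : ∀ k, Q.pt k ≤ T → -M ≤ (φ (y k)).toReal :=
    hM Q y hy (fun k => (hQm k).trans hhh₁)
  have hFM : 0 ≤ F + M := by
    have := hxM 0 ((P.strictMono.monotone (Nat.zero_le i)).trans hi)
    rw [hx.1] at this
    linarith
  have hb : ∀ (P : TimePartition) (x : ℕ → X), IsDiscreteSolution φ P x₀ x → ∀ k,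
      -M ≤ (φ (x k)).toReal → dist x₀ (x k) ^ 2 ≤ 2 * (F + M) * P.pt k := by
    intro P x hx k hk
    refine (hx.dist_sq_le hbot hx₀ k).trans ?_
    exact mul_le_mul_of_nonneg_right (by linarith) (P.pt_nonneg k)
  have hcl := crandall_liggett (t := P.pt) (s := Q.pt) (f := fun k => (φ (x k)).toReal)
    (g := fun k => (φ (y k)).toReal) (a := fun i j => dist (x i) (y j) ^ 2) (I := i) (J := j)
    (h := h) (μ := μ) (C := C) (c := 2 * (F + M)) (F := F) hμ0 hC (by positivity) hh2
    P.pt_zero Q.pt_zero P.strictMono Q.strictMono hPm hQm (hx.antitone hbot hx₀)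
    (hy.antitone hbot hx₀) (hx.toReal_le hbot hx₀ 0) (hy.toReal_le hbot hx₀ 0)
    (by
      intro k _ l _
      have hτ := P.step_pos k
      have hσ := Q.step_pos l
      have ex := hevi _ (hx.mem_domain hx₀ k) _ hτ _ (hx.2 k) _ (hy.mem_domain hx₀ (l + 1))
      have ey := hevi _ (hy.mem_domain hx₀ l) _ hσ _ (hy.2 l) _ (hx.mem_domain hx₀ (k + 1))
      have sx := mul_le_mul_of_nonneg_left (hx.dist_sq_step_le hbot hx₀ k) hC
      have sy := mul_le_mul_of_nonneg_left (hy.dist_sq_step_le hbot hx₀ l) hC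
      rw [dist_comm (y (l + 1)) (x (k + 1)), dist_comm (y l) (x (k + 1))] at ey
      obtain ⟨τ, hτe⟩ : ∃ τ, τ = P.pt (k + 1) - P.pt k := ⟨_, rfl⟩
      obtain ⟨σ, hσe⟩ : ∃ σ, σ = Q.pt (l + 1) - Q.pt l := ⟨_, rfl⟩
      rw [← hτe] at hτ ex sx ⊢
      rw [← hσe] at hσ ey sy ⊢
      -- With weight `σ` on the inequality for `x` and `τ` on that for `y`, the terms
      -- `±2τσ(φ(x^{k+1}) - φ(y^{l+1}))` cancel.
      have ex' := mul_le_mul_of_nonneg_left (ex.trans (add_le_add_right sx _)) hσ.le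
      have ey' := mul_le_mul_of_nonneg_left (ey.trans (add_le_add_right sy _)) hτ.le
      have hl : 0 ≤ (μ + lam) * (2 * (τ * σ) * dist (x (k + 1)) (y (l + 1)) ^ 2) :=
        mul_nonneg (by linarith [neg_abs_le lam]) (by positivity)
      linarith)
    (by
      intro k hk
      simp only [hy.1, dist_comm _ x₀]
      exact hb P x hx k (hxM k ((P.strictMono.monotone hk).trans hi)))
    (by
      intro k hk
      simp only [hx.1]
      exact hb Q y hy k (hyM k ((Q.strictMono.monotone hk).trans hj)))
    i le_rfl j le_rfl
  refine hcl.trans ?_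
  rw [mul_assoc (Real.exp _)]
  have hP0 := P.pt_nonneg i
  have hQ0 := Q.pt_nonneg j
  have hxi := hxM i hi
  have hyj := hyM j hj
  have s1 : √((P.pt i - Q.pt j) ^ 2 + h * (P.pt i + Q.pt j))
      ≤ √((P.pt i - Q.pt j) ^ 2 + 2 * h * T) := by
    refine Real.sqrt_le_sqrt ?_
    have := mul_le_mul_of_nonneg_left (by linarith : P.pt i + Q.pt j ≤ 2 * T) hh0
    linarith
  have s2 : 2 * C * h * (2 * F - (φ (x i)).toReal - (φ (y j)).toReal)
      ≤ 4 * C * (F + M) * h := by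
    have := mul_le_mul_of_nonneg_left
      (by linarith : 2 * F - (φ (x i)).toReal - (φ (y j)).toReal ≤ 2 * (F + M))
      (by positivity : 0 ≤ 2 * C * h)
    linarith
  have hxF := hx.toReal_le hbot hx₀ i
  have hyF := hy.toReal_le hbot hx₀ j
  have s3 := mul_le_mul_of_nonneg_left s1 (by positivity : 0 ≤ 2 * (F + M))
  have s4 : 0 ≤ 4 * C * (F + M) * √((P.pt i - Q.pt j) ^ 2 + 2 * h * T) := by positivity
  have s5 : 0 ≤ 2 * (F + M) * h := by positivity
  have s6 : 0 ≤ 2 * (F + M) * √((P.pt i - Q.pt j) ^ 2 + h * (P.pt i + Q.pt j))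
      + 2 * C * h * (2 * F - (φ (x i)).toReal - (φ (y j)).toReal) := by
    have : 0 ≤ 2 * F - (φ (x i)).toReal - (φ (y j)).toReal := by linarith
    positivity
  have s7 : Real.exp (4 * μ * (P.pt i + Q.pt j)) ≤ Real.exp (4 * μ * (T + T)) := by gcongr
  refine (mul_le_mul_of_nonneg_right s7 s6).trans (mul_le_mul_of_nonneg_left ?_
    (Real.exp_pos _).le)
  linarith

end EVIFlow

/-! ### Partitions, interpolation and existence of the gradient curve -/

namespace EVIFlow

namespace TimePartition

theorem exists_le_pt (P : TimePartition) (t : ℝ) : {k : ℕ | t ≤ P.pt k}.Nonempty :=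
  (P.unbounded.eventually_ge_atTop t).exists

theorem le_pt_sInf (P : TimePartition) (t : ℝ) : t ≤ P.pt (sInf {k : ℕ | t ≤ P.pt k}) :=
  Nat.sInf_mem (P.exists_le_pt t)

theorem pt_sInf_le (P : TimePartition) {h t : ℝ} (hh : ∀ k, P.pt (k + 1) - P.pt k ≤ h)
    (ht : 0 ≤ t) : P.pt (sInf {k : ℕ | t ≤ P.pt k}) ≤ t + h := by
  have hh0 : 0 ≤ h := (P.step_pos 0).le.trans (hh 0)
  rcases hk : sInf {k : ℕ | t ≤ P.pt k} with _ | k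
  · rw [P.pt_zero]; positivity
  · have : k ∉ {k : ℕ | t ≤ P.pt k} := Nat.notMem_of_lt_sInf (by omega)
    have h1 : P.pt k < t := not_le.1 this
    linarith [hh k]

theorem sInf_pt (P : TimePartition) (k : ℕ) : sInf {l : ℕ | P.pt k ≤ P.pt l} = k := by
  refine le_antisymm (Nat.sInf_le (le_refl (P.pt k))) (le_csInf ⟨k, le_refl (P.pt k)⟩ fun l hl => ?_)
  exact P.strictMono.le_iff_le.1 hl

theorem step_le_of_mesh_lt (P : TimePartition) {h : ℝ} (hP : P.mesh < ENNReal.ofReal h) (k : ℕ) :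
    P.pt (k + 1) - P.pt k ≤ h := by
  have h1 : ENNReal.ofReal (P.pt (k + 1) - P.pt k) < ENNReal.ofReal h :=
    (le_iSup (fun k : ℕ => ENNReal.ofReal (P.pt (k + 1) - P.pt k)) k).trans_lt hP
  exact ((ENNReal.ofReal_lt_ofReal_iff_of_nonneg (P.step_pos k).le).1 h1).le

/-- The partition into intervals of constant length. -/
def uniform (h : ℝ) (hh : 0 < h) : TimePartition where
  pt k := k * h
  pt_zero := by simp
  strictMono := fun _ _ hab => mul_lt_mul_of_pos_right (Nat.cast_lt.2 hab) hh
  unbounded := tendsto_natCast_atTop_atTop.atTop_mul_const hh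

theorem uniform_step (h : ℝ) (hh : 0 < h) (k : ℕ) :
    (uniform h hh).pt (k + 1) - (uniform h hh).pt k = h := by
  simp only [uniform]; push_cast; ring

theorem mesh_uniform (h : ℝ) (hh : 0 < h) : (uniform h hh).mesh = ENNReal.ofReal h := by
  simp [mesh, uniform_step]

end TimePartition

theorem interpolate_pt {X : Type*} (P : TimePartition) (x : ℕ → X) (k : ℕ) :
    interpolate P x (P.pt k) = x k := by
  rw [interpolate, P.sInf_pt]

variable {X : Type*} [MetricSpace X] {φ : X → EReal} {x₀ : X}

theorem exists_discreteSolution (hx₀ : x₀ ∈ domain φ) {δ : ℝ}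
    (hmin : ∀ x ∈ domain φ, ∀ τ : ℝ, 0 < τ → τ < δ → (minimizerSet φ τ x).Nonempty)
    (P : TimePartition) (hP : P.mesh < ENNReal.ofReal δ) :
    ∃ x : ℕ → X, IsDiscreteSolution φ P x₀ x := by
  have hstep : ∀ k, P.pt (k + 1) - P.pt k < δ := fun k => by
    have h1 : ENNReal.ofReal (P.pt (k + 1) - P.pt k) < ENNReal.ofReal δ :=
      (le_iSup (fun k : ℕ => ENNReal.ofReal (P.pt (k + 1) - P.pt k)) k).trans_lt hP
    exact (ENNReal.ofReal_lt_ofReal_iff_of_nonneg (P.step_pos k).le).1 h1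
  choose! F hF using hmin
  let x : ℕ → X := fun k => Nat.rec x₀ (fun k z => F z (P.pt (k + 1) - P.pt k)) k
  have hx : ∀ k, x k ∈ domain φ := by
    intro k
    induction k with
    | zero => exact hx₀
    | succ k ih => exact mem_domain_of_mem_minimizerSet (hF _ ih _ (P.step_pos k) (hstep k)) hx₀
  exact ⟨x, rfl, fun k => hF _ (hx k) _ (P.step_pos k) (hstep k)⟩

/-- The value at time `t` is taken at a grid point overshooting `t` by at most `h ≤ 1`; hence the
horizon `T + 1` and the shift of `|t - s|` by `h`. -/
theorem exists_dist_sq_interpolate_le (hbot : ∀ x, φ x ≠ ⊥) (hx₀ : x₀ ∈ domain φ)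
    {lam C A B : ℝ} (hC : 0 ≤ C) (hB : 0 ≤ B) (hevi : OneStepEVI lam C φ)
    (hlow : ∀ z ∈ domain φ, -A - B * dist x₀ z ^ 2 ≤ (φ z).toReal) {T : ℝ} :
    ∃ h₀ > 0, ∃ G : ℝ, ∀ h ≤ h₀, ∀ (P Q : TimePartition) (x y : ℕ → X),
      IsDiscreteSolution φ P x₀ x → IsDiscreteSolution φ Q x₀ y →
      (∀ k, P.pt (k + 1) - P.pt k ≤ h) → (∀ k, Q.pt (k + 1) - Q.pt k ≤ h) →
      ∀ t ∈ Icc 0 T, ∀ s ∈ Icc 0 T,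
        dist (interpolate P x t) (interpolate Q y s) ^ 2
          ≤ G * (√((|t - s| + h) ^ 2 + 2 * h * (T + 1)) + h) := by
  obtain ⟨h₁, hh₁, G, hG⟩ :=
    exists_dist_sq_discreteSolution_le (T := T + 1) hbot hx₀ hC hB hevi hlow
  refine ⟨min h₁ 1, by positivity, |G|, fun h hh P Q x y hx hy hP hQ t ht s hs => ?_⟩
  have hhh₁ : h ≤ h₁ := hh.trans (min_le_left _ _)
  have hhh2 : h ≤ 1 := hh.trans (min_le_right _ _)
  have hh0 : 0 ≤ h := (P.step_pos 0).le.trans (hP 0)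
  have hi := P.pt_sInf_le hP ht.1
  have hj := Q.pt_sInf_le hQ hs.1
  have hi' := P.le_pt_sInf t
  have hj' := Q.le_pt_sInf s
  have h1 := hG h hhh₁ P Q x y hx hy hP hQ _ _ (by linarith [ht.2] : _ ≤ T + 1)
    (by linarith [hs.2] : _ ≤ T + 1)
  refine h1.trans ?_
  refine (mul_le_mul_of_nonneg_right (le_abs_self G) (by positivity)).trans ?_
  have h2 : |P.pt (sInf {k : ℕ | t ≤ P.pt k}) - Q.pt (sInf {k : ℕ | s ≤ Q.pt k})|
      ≤ |t - s| + h := by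
    have h3 := le_abs_self (t - s)
    have h4 := neg_abs_le (t - s)
    rw [abs_le]
    constructor <;> linarith
  rw [← sq_abs (P.pt _ - Q.pt _)]
  gcongr

/-- Existence of the gradient curve. -/
theorem exists_gradientCurve [CompleteSpace X] (hbot : ∀ x, φ x ≠ ⊥) (hx₀ : x₀ ∈ domain φ)
    {lam C A B δ : ℝ} (hC : 0 ≤ C) (hB : 0 ≤ B) (hevi : OneStepEVI lam C φ)
    (hlow : ∀ z ∈ domain φ, -A - B * dist x₀ z ^ 2 ≤ (φ z).toReal) (hδ : 0 < δ)
    (hmin : ∀ x ∈ domain φ, ∀ τ : ℝ, 0 < τ → τ < δ → (minimizerSet φ τ x).Nonempty) :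
    ∃ ξ : ℝ → X, IsGradientCurve φ x₀ ξ := by
  have hex := exists_discreteSolution hx₀ hmin
  -- The Cauchy estimate holds for any two fine partitions, so the limit along one sequence of
  -- uniform partitions is the limit along all sequences.
  have hcauchy : ∀ T : ℝ, ∀ ε > 0, ∃ h > 0, ∀ (P Q : TimePartition) (x y : ℕ → X),
      IsDiscreteSolution φ P x₀ x → IsDiscreteSolution φ Q x₀ y →
      (∀ k, P.pt (k + 1) - P.pt k ≤ h) → (∀ k, Q.pt (k + 1) - Q.pt k ≤ h) →
      ∀ t ∈ Icc 0 T, dist (interpolate P x t) (interpolate Q y t) < ε := by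
    intro T ε hε
    obtain ⟨h₀, hh₀, G, hG⟩ :=
      exists_dist_sq_interpolate_le (T := T) hbot hx₀ hC hB hevi hlow
    have hlim : Tendsto (fun h : ℝ => G * (√((|(0 : ℝ)| + h) ^ 2 + 2 * h * (T + 1)) + h))
        (𝓝[>] 0) (𝓝 (G * (√((|(0 : ℝ)| + 0) ^ 2 + 2 * 0 * (T + 1)) + 0))) :=
      Tendsto.mono_left (Continuous.tendsto (by fun_prop) 0) nhdsWithin_le_nhds
    simp only [abs_zero, add_zero, mul_zero, zero_mul, ne_eq, OfNat.ofNat_ne_zero,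
      not_false_eq_true, zero_pow, Real.sqrt_zero] at hlim
    obtain ⟨h, h1, h2⟩ := ((hlim.eventually_lt_const (by positivity : 0 < ε ^ 2)).and
      (Ioc_mem_nhdsGT hh₀)).exists
    refine ⟨h, h2.1, fun P Q x y hx hy hP hQ t ht => ?_⟩
    have h3 := hG h h2.2 P Q x y hx hy hP hQ t ht t ht
    rw [sub_self, abs_zero] at h3
    exact lt_of_pow_lt_pow_left₀ 2 hε.le (h3.trans_lt h1)
  -- The denominator `n + 2` keeps the mesh strictly below `δ` already for `n = 0`.
  have hseq : ∀ n : ℕ, 0 < δ / (n + 2) := fun n => by positivity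
  have hsol : ∀ n : ℕ, ∃ x, IsDiscreteSolution φ (TimePartition.uniform _ (hseq n)) x₀ x := by
    intro n
    refine hex _ ?_
    rw [TimePartition.mesh_uniform]
    refine (ENNReal.ofReal_lt_ofReal_iff hδ).2 (div_lt_self hδ ?_)
    have : (0 : ℝ) ≤ n := n.cast_nonneg
    linarith
  choose z hz using hsol
  have hto : Tendsto (fun n : ℕ => δ / ((n : ℝ) + 2)) atTop (𝓝 0) :=
    tendsto_const_nhds.div_atTop (tendsto_atTop_add_const_right _ _ tendsto_natCast_atTop_atTop)
  have hc : ∀ t : ℝ, 0 ≤ t → ∃ p, Tendsto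
      (fun n => interpolate (TimePartition.uniform _ (hseq n)) (z n) t) atTop (𝓝 p) := by
    intro t ht
    refine cauchySeq_tendsto_of_complete (Metric.cauchySeq_iff.2 fun ε hε => ?_)
    obtain ⟨h, hh, hH⟩ := hcauchy t ε hε
    obtain ⟨N, hN⟩ := eventually_atTop.1 (hto.eventually_le_const hh)
    refine ⟨N, fun m hm n hn => hH _ _ _ _ (hz m) (hz n) ?_ ?_ t ⟨ht, le_rfl⟩⟩
    · exact fun k => (TimePartition.uniform_step _ _ _).trans_le (hN m hm)
    · exact fun k => (TimePartition.uniform_step _ _ _).trans_le (hN n hn)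
  have : Nonempty X := ⟨x₀⟩
  choose! ξ hξ using hc
  refine ⟨ξ, ⟨δ, hδ, hex⟩, fun P x hmesh hx T => ?_⟩
  rw [Metric.tendstoUniformlyOn_iff]
  intro ε hε
  obtain ⟨h, hh, hH⟩ := hcauchy T (ε / 2) (half_pos hε)
  filter_upwards [hmesh.eventually_lt_const (ENNReal.ofReal_pos.2 hh)] with n hn t ht
  rw [dist_comm]
  refine lt_of_le_of_lt ?_ (half_lt_self hε)
  refine le_of_tendsto (tendsto_const_nhds.dist (hξ t ht.1)) ?_
  filter_upwards [hto.eventually_le_const hh] with m hm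
  exact (hH _ _ _ _ (hx n) (hz m) ((P n).step_le_of_mesh_lt hn)
    (fun k => (TimePartition.uniform_step _ _ _).trans_le hm) t ht).le

end EVIFlow

/-! ### Passage to the limit: the evolution variational inequality -/

namespace EVIFlow

variable {X : Type*} [MetricSpace X] {φ : X → EReal} {x₀ : X} {ξ : ℝ → X}

/-- The one-step inequality summed from `m` to `n`: `L` bounds the drift, and the quadratic errors
telescope into a drop of the potential times `h`. -/
theorem IsDiscreteSolution.dist_sq_sub_le {P : TimePartition} {x : ℕ → X} (hbot : ∀ x, φ x ≠ ⊥)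
    (hx : IsDiscreteSolution φ P x₀ x) (hx₀ : x₀ ∈ domain φ) {lam C h L : ℝ} {y : X} (hC : 0 ≤ C)
    (hevi : OneStepEVI lam C φ) (hy : y ∈ domain φ) (hh : ∀ k, P.pt (k + 1) - P.pt k ≤ h)
    {m n : ℕ} (hmn : m ≤ n)
    (hL : ∀ k, m < k → k ≤ n →
      -lam * dist (x k) y ^ 2 + 2 * ((φ y).toReal - (φ (x k)).toReal) ≤ L) :
    dist (x n) y ^ 2 - dist (x m) y ^ 2
      ≤ (P.pt n - P.pt m) * L + 2 * C * h * ((φ (x m)).toReal - (φ (x n)).toReal) := by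
  induction n, hmn using Nat.le_induction with
  | base => simp
  | succ n hmn ih =>
    have ih := ih fun k h1 h2 => hL k h1 (by omega)
    have hl := hL (n + 1) (by omega) le_rfl
    have hτ := P.step_pos n
    have he := hevi _ (hx.mem_domain hx₀ n) _ hτ _ (hx.2 n) y hy
    have hs := hx.dist_sq_step_le hbot hx₀ n
    have hmono := hx.antitone hbot hx₀ (Nat.le_succ n)
    simp only at hmono
    have g1 : C * dist (x n) (x (n + 1)) ^ 2
        ≤ 2 * C * h * ((φ (x n)).toReal - (φ (x (n + 1))).toReal) := by
      have : 2 * (P.pt (n + 1) - P.pt n) * ((φ (x n)).toReal - (φ (x (n + 1))).toReal)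
          ≤ 2 * h * ((φ (x n)).toReal - (φ (x (n + 1))).toReal) :=
        mul_le_mul_of_nonneg_right (by linarith [hh n]) (by linarith)
      have := mul_le_mul_of_nonneg_left (hs.trans this) hC
      linarith
    have g2 := mul_le_mul_of_nonneg_left hl hτ.le
    linarith

/-- `ξ` is the limit of the interpolations of the discrete solutions `x n` on partitions `P n`
whose step sizes are at most `h n → 0`. -/
structure IsApproximation (φ : X → EReal) (x₀ : X) (ξ : ℝ → X) (P : ℕ → TimePartition)
    (x : ℕ → ℕ → X) (h : ℕ → ℝ) : Prop where
  sol : ∀ n, IsDiscreteSolution φ (P n) x₀ (x n)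
  step : ∀ n k, (P n).pt (k + 1) - (P n).pt k ≤ h n
  tendsto_zero : Tendsto h atTop (𝓝 0)
  unif : ∀ T : ℝ, TendstoUniformlyOn (fun i t => interpolate (P i) (x i) t) ξ atTop (Icc 0 T)

theorem IsGradientCurve.exists_approximation (hξ : IsGradientCurve φ x₀ ξ) :
    ∃ P x h, IsApproximation φ x₀ ξ P x h := by
  obtain ⟨⟨δ, hδ, hex⟩, hlim⟩ := hξ
  have hseq : ∀ n : ℕ, 0 < δ / (n + 2) := fun n => by positivity
  have hsol : ∀ n : ℕ, ∃ x, IsDiscreteSolution φ (TimePartition.uniform _ (hseq n)) x₀ x := by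
    intro n
    refine hex _ ?_
    rw [TimePartition.mesh_uniform]
    refine (ENNReal.ofReal_lt_ofReal_iff hδ).2 (div_lt_self hδ ?_)
    have : (0 : ℝ) ≤ n := n.cast_nonneg
    linarith
  choose x hx using hsol
  have hto : Tendsto (fun n : ℕ => δ / ((n : ℝ) + 2)) atTop (𝓝 0) :=
    tendsto_const_nhds.div_atTop (tendsto_atTop_add_const_right _ _ tendsto_natCast_atTop_atTop)
  refine ⟨_, x, _, hx, fun n k => (TimePartition.uniform_step _ _ _).le, hto, ?_⟩
  refine hlim _ x ?_ hx
  simp only [TimePartition.mesh_uniform]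
  have := ENNReal.tendsto_ofReal hto
  rwa [ENNReal.ofReal_zero] at this

namespace IsApproximation

variable {P : ℕ → TimePartition} {x : ℕ → ℕ → X} {h : ℕ → ℝ}

theorem tendsto (ha : IsApproximation φ x₀ ξ P x h) {t : ℝ} (ht : 0 ≤ t) :
    Tendsto (fun n => interpolate (P n) (x n) t) atTop (𝓝 (ξ t)) :=
  (ha.unif t).tendsto_at ⟨ht, le_rfl⟩

theorem tendsto_pt (ha : IsApproximation φ x₀ ξ P x h) {t : ℝ} (ht : 0 ≤ t) :
    Tendsto (fun n => (P n).pt (sInf {k : ℕ | t ≤ (P n).pt k})) atTop (𝓝 t) := by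
  refine tendsto_of_tendsto_of_tendsto_of_le_of_le (g := fun _ => t) (h := fun n => t + h n)
    tendsto_const_nhds ?_ (fun n => (P n).le_pt_sInf t)
    (fun n => (P n).pt_sInf_le (ha.step n) ht)
  simpa using tendsto_const_nhds.add ha.tendsto_zero

/-- The potential stays below `φ x₀` along discrete solutions, and lower semicontinuity excludes an
infinite value at the limit. -/
theorem mem_domain (ha : IsApproximation φ x₀ ξ P x h) (hbot : ∀ x, φ x ≠ ⊥)
    (hlsc : LowerSemicontinuous φ) (hx₀ : x₀ ∈ domain φ) {t : ℝ} (ht : 0 ≤ t) :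
    ξ t ∈ domain φ := by
  intro htop
  have h1 := hlsc (ξ t) (φ x₀) (by show φ x₀ < φ (ξ t); rw [htop]; exact lt_top_iff_ne_top.2 hx₀)
  obtain ⟨n, hn⟩ := ((ha.tendsto ht).eventually h1).exists
  have hmem := (ha.sol n).mem_domain hx₀ (sInf {k : ℕ | t ≤ (P n).pt k})
  have h2 := (ha.sol n).toReal_le hbot hx₀ (sInf {k : ℕ | t ≤ (P n).pt k})
  refine absurd hn (not_lt.2 ?_)
  rw [interpolate, ← EReal.coe_toReal hmem (hbot _), ← EReal.coe_toReal hx₀ (hbot _)]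
  exact_mod_cast h2

/-- The telescoped error has the factor `h n` and vanishes in the limit. The margin `η` accounts for
grid points beyond `t`. -/
theorem dist_sq_sub_le (ha : IsApproximation φ x₀ ξ P x h) (hbot : ∀ x, φ x ≠ ⊥)
    (hx₀ : x₀ ∈ domain φ) {lam C L M s t η : ℝ} {y : X} (hC : 0 ≤ C) (hevi : OneStepEVI lam C φ)
    (hy : y ∈ domain φ) (hs : 0 ≤ s) (hst : s ≤ t) (hη : 0 < η)
    (hM : ∀ᶠ n in atTop, ∀ k, (P n).pt k ≤ t + η → -M ≤ (φ (x n k)).toReal)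
    (hL : ∀ᶠ n in atTop, ∀ k, s ≤ (P n).pt k → (P n).pt k ≤ t + η →
      -lam * dist (x n k) y ^ 2 + 2 * ((φ y).toReal - (φ (x n k)).toReal) ≤ L) :
    dist (ξ t) y ^ 2 - dist (ξ s) y ^ 2 ≤ (t - s) * L := by
  have ht := hs.trans hst
  have hl : Tendsto (fun n => dist (interpolate (P n) (x n) t) y ^ 2
      - dist (interpolate (P n) (x n) s) y ^ 2) atTop
      (𝓝 (dist (ξ t) y ^ 2 - dist (ξ s) y ^ 2)) :=
    (((ha.tendsto ht).dist tendsto_const_nhds).pow 2).sub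
      (((ha.tendsto hs).dist tendsto_const_nhds).pow 2)
  have hr : Tendsto (fun n => ((P n).pt (sInf {k : ℕ | t ≤ (P n).pt k})
      - (P n).pt (sInf {k : ℕ | s ≤ (P n).pt k})) * L + 2 * C * h n * ((φ x₀).toReal + M)) atTop
      (𝓝 ((t - s) * L + 2 * C * 0 * ((φ x₀).toReal + M))) :=
    (((ha.tendsto_pt ht).sub (ha.tendsto_pt hs)).mul_const L).add
      ((ha.tendsto_zero.const_mul _).mul_const _)
  rw [mul_zero, zero_mul, add_zero] at hr
  refine le_of_tendsto_of_tendsto hl hr ?_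
  filter_upwards [hM, hL, ha.tendsto_zero.eventually_le_const hη] with n hMn hLn hhn
  have hh0 : 0 ≤ h n := ((P n).step_pos 0).le.trans (ha.step n 0)
  have hpt := (P n).pt_sInf_le (ha.step n) ht
  have hmn : sInf {k : ℕ | s ≤ (P n).pt k} ≤ sInf {k : ℕ | t ≤ (P n).pt k} :=
    Nat.sInf_le (hst.trans ((P n).le_pt_sInf t))
  have hmain := (ha.sol n).dist_sq_sub_le hbot hx₀ hC hevi hy (ha.step n) hmn (L := L)
    (fun k h1 h2 => by
      refine hLn k (((P n).le_pt_sInf s).trans ((P n).strictMono h1).le) ?_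
      have := (P n).strictMono.monotone h2
      linarith)
  refine hmain.trans (add_le_add_right ?_ _)
  have h1 := (ha.sol n).toReal_le hbot hx₀ (sInf {k : ℕ | s ≤ (P n).pt k})
  have h2 := hMn (sInf {k : ℕ | t ≤ (P n).pt k}) (by linarith)
  exact mul_le_mul_of_nonneg_left (by linarith) (by positivity)

/-- The interpolation estimate applied to a solution and itself: as the mesh tends to zero, the
right side becomes linear in `|t - s|`. -/
theorem exists_dist_sq_le (ha : IsApproximation φ x₀ ξ P x h) (hbot : ∀ x, φ x ≠ ⊥)
    (hx₀ : x₀ ∈ domain φ) {lam C A B : ℝ} (hC : 0 ≤ C) (hB : 0 ≤ B) (hevi : OneStepEVI lam C φ)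
    (hlow : ∀ z ∈ domain φ, -A - B * dist x₀ z ^ 2 ≤ (φ z).toReal) (T : ℝ) :
    ∃ G : ℝ, ∀ t ∈ Icc 0 T, ∀ s ∈ Icc 0 T, dist (ξ t) (ξ s) ^ 2 ≤ G * |t - s| := by
  obtain ⟨h₀, hh₀, G, hG⟩ := exists_dist_sq_interpolate_le (T := T) hbot hx₀ hC hB hevi hlow
  refine ⟨G, fun t ht s hs => ?_⟩
  have hl : Tendsto (fun n => G * (√((|t - s| + h n) ^ 2 + 2 * h n * (T + 1)) + h n)) atTop
      (𝓝 (G * (√((|t - s| + 0) ^ 2 + 2 * 0 * (T + 1)) + 0))) := by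
    have : Continuous fun r : ℝ => G * (√((|t - s| + r) ^ 2 + 2 * r * (T + 1)) + r) := by
      fun_prop
    exact (this.tendsto 0).comp ha.tendsto_zero
  rw [add_zero, mul_zero, zero_mul, add_zero, add_zero, Real.sqrt_sq (abs_nonneg _)] at hl
  refine le_of_tendsto_of_tendsto (((ha.tendsto ht.1).dist (ha.tendsto hs.1)).pow 2) hl ?_
  filter_upwards [ha.tendsto_zero.eventually_le_const hh₀] with n hn
  exact hG (h n) hn _ _ _ _ (ha.sol n) (ha.sol n) (ha.step n) (ha.step n) t ht s hs

theorem exists_lower_bound (ha : IsApproximation φ x₀ ξ P x h) (hbot : ∀ x, φ x ≠ ⊥)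
    (hx₀ : x₀ ∈ domain φ) {lam C A B : ℝ} (hC : 0 ≤ C) (hB : 0 ≤ B) (hevi : OneStepEVI lam C φ)
    (hlow : ∀ z ∈ domain φ, -A - B * dist x₀ z ^ 2 ≤ (φ z).toReal) (T : ℝ) :
    ∃ M : ℝ, ∀ᶠ n in atTop, ∀ k, (P n).pt k ≤ T → -M ≤ (φ (x n k)).toReal := by
  obtain ⟨h₀, hh₀, M, hM⟩ :=
    exists_lower_bound_discreteSolution (T := T) hbot hx₀ hC hB hevi hlow
  refine ⟨M, ?_⟩
  filter_upwards [ha.tendsto_zero.eventually_le_const hh₀] with n hn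
  exact hM (P n) (x n) (ha.sol n) fun k => (ha.step n k).trans hn

/-- The forward difference quotients of the squared distance to `y` satisfy the evolution
variational inequality asymptotically. -/
theorem eventually_slope_le (ha : IsApproximation φ x₀ ξ P x h) (hbot : ∀ x, φ x ≠ ⊥)
    (hlsc : LowerSemicontinuous φ)
    (hx₀ : x₀ ∈ domain φ) {lam C A B : ℝ} (hC : 0 ≤ C) (hB : 0 ≤ B) (hevi : OneStepEVI lam C φ)
    (hlow : ∀ z ∈ domain φ, -A - B * dist x₀ z ^ 2 ≤ (φ z).toReal) {y : X} (hy : y ∈ domain φ)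
    {t δ : ℝ} (ht : 0 ≤ t) (hδ : 0 < δ) :
    ∀ᶠ ε in 𝓝[>] (0 : ℝ), (dist (ξ (t + ε)) y ^ 2 - dist (ξ t) y ^ 2) / (2 * ε)
      ≤ -(lam / 2) * dist (ξ t) y ^ 2 + ((φ y).toReal - (φ (ξ t)).toReal) + δ := by
  have hξd := ha.mem_domain hbot hlsc hx₀ ht
  set L := -lam * dist (ξ t) y ^ 2 + 2 * ((φ y).toReal - (φ (ξ t)).toReal) + 2 * δ with hL
  -- Lower semicontinuity bounds the drift by `L` only near `ξ t`; Hölder continuity and uniform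
  -- convergence then keep all relevant discrete points in that ball, each contributing `r / 2`.
  have hnear : ∀ᶠ w in 𝓝 (ξ t), w ∈ domain φ →
      -lam * dist w y ^ 2 + 2 * ((φ y).toReal - (φ w).toReal) ≤ L := by
    have h1 : (((φ (ξ t)).toReal - δ / 2 : ℝ) : EReal) < φ (ξ t) := by
      conv_rhs => rw [← EReal.coe_toReal hξd (hbot _)]
      exact_mod_cast sub_lt_self _ (half_pos hδ)
    have h2 : Tendsto (fun w => -lam * dist w y ^ 2) (𝓝 (ξ t)) (𝓝 (-lam * dist (ξ t) y ^ 2)) :=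
      Continuous.tendsto (by fun_prop) _
    filter_upwards [hlsc _ _ h1, h2.eventually_le_const (lt_add_of_pos_right _ hδ)] with w g1 g2 hw
    rw [← EReal.coe_toReal hw (hbot _)] at g1
    have g3 : (φ (ξ t)).toReal - δ / 2 < (φ w).toReal := by exact_mod_cast g1
    linarith
  obtain ⟨r, hr, hball⟩ := Metric.eventually_nhds_iff.1 hnear
  obtain ⟨G, hG⟩ := ha.exists_dist_sq_le hbot hx₀ hC hB hevi hlow (t + 1)
  have hcont : Tendsto (fun ε : ℝ => G * |t + ε - t|) (𝓝 0) (𝓝 (G * |t + 0 - t|)) :=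
    Continuous.tendsto (by fun_prop) 0
  rw [add_zero, sub_self, abs_zero, mul_zero] at hcont
  obtain ⟨ρ, hρ, hρG⟩ := Metric.eventually_nhds_iff.1
    (hcont.eventually_lt_const (by positivity : 0 < (r / 2) ^ 2))
  -- The window has length `2κ`: one `κ` for the increment `ε`, one for the grid overshoot.
  set κ := min (ρ / 2) 1 / 2 with hκ
  have hκ0 : 0 < κ := by positivity
  have hκρ : 2 * κ ≤ ρ / 2 := by rw [hκ]; linarith [min_le_left (ρ / 2) 1]
  have hκ1 : 2 * κ ≤ 1 := by rw [hκ]; linarith [min_le_right (ρ / 2) 1]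
  obtain ⟨M, hM⟩ := ha.exists_lower_bound hbot hx₀ hC hB hevi hlow (t + 1)
  have hLn : ∀ᶠ n in atTop, ∀ k, t ≤ (P n).pt k → (P n).pt k ≤ t + 2 * κ →
      -lam * dist (x n k) y ^ 2 + 2 * ((φ y).toReal - (φ (x n k)).toReal) ≤ L := by
    filter_upwards [Metric.tendstoUniformlyOn_iff.1 (ha.unif (t + 1)) (r / 2) (half_pos hr)]
      with n hn k hk1 hk2
    have hk : (P n).pt k ∈ Icc 0 (t + 1) := ⟨ht.trans hk1, by linarith⟩
    have d1 := hn _ hk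
    rw [interpolate_pt, dist_comm] at d1
    have d2 : dist (ξ ((P n).pt k)) (ξ t) < r / 2 := by
      refine lt_of_pow_lt_pow_left₀ 2 (by positivity) ?_
      refine (hG _ hk t ⟨ht, by linarith⟩).trans_lt ?_
      have := @hρG ((P n).pt k - t) (by
        rw [Real.dist_eq, sub_zero, abs_of_nonneg (by linarith)]; linarith)
      simpa using this
    refine hball ?_ ((ha.sol n).mem_domain hx₀ k)
    linarith [dist_triangle (x n k) (ξ ((P n).pt k)) (ξ t)]
  filter_upwards [Ioo_mem_nhdsGT hκ0] with ε hε
  have hmain := ha.dist_sq_sub_le hbot hx₀ hC hevi hy ht (by linarith [hε.1] : t ≤ t + ε) hκ0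
    (by filter_upwards [hM] with n hn k hk using hn k (by linarith [hε.2]))
    (L := L) (by filter_upwards [hLn] with n hn k hk1 hk2 using hn k hk1 (by linarith [hε.2]))
  have hε0 := hε.1
  rw [div_le_iff₀ (by positivity)]
  refine hmain.trans_eq ?_
  rw [hL]
  ring

theorem limsup_evi (ha : IsApproximation φ x₀ ξ P x h) (hbot : ∀ x, φ x ≠ ⊥)
    (hlsc : LowerSemicontinuous φ)
    (hx₀ : x₀ ∈ domain φ) {lam C A B : ℝ} (hC : 0 ≤ C) (hB : 0 ≤ B) (hevi : OneStepEVI lam C φ)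
    (hlow : ∀ z ∈ domain φ, -A - B * dist x₀ z ^ 2 ≤ (φ z).toReal) {y : X} (hy : y ∈ domain φ)
    {t : ℝ} (ht : 0 ≤ t) :
    limsup (fun ε : ℝ =>
        (((dist (ξ (t + ε)) y ^ 2 - dist (ξ t) y ^ 2) / (2 * ε) : ℝ) : EReal)) (𝓝[>] 0)
      + ((lam / 2 * dist (ξ t) y ^ 2 : ℝ) : EReal) + φ (ξ t) ≤ φ y := by
  have hξd := ha.mem_domain hbot hlsc hx₀ ht
  have hle : limsup (fun ε : ℝ =>
        (((dist (ξ (t + ε)) y ^ 2 - dist (ξ t) y ^ 2) / (2 * ε) : ℝ) : EReal)) (𝓝[>] 0)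
      ≤ ((-(lam / 2) * dist (ξ t) y ^ 2 + ((φ y).toReal - (φ (ξ t)).toReal) : ℝ) : EReal) := by
    refine EReal.le_of_forall_lt_iff_le.1 fun z hz => ?_
    have hz' := EReal.coe_lt_coe_iff.1 hz
    refine limsup_le_of_le (by isBoundedDefault) ?_
    filter_upwards [ha.eventually_slope_le hbot hlsc hx₀ hC hB hevi hlow hy ht (sub_pos.2 hz')]
      with ε hε
    exact_mod_cast hε.trans_eq (by ring)
  refine (add_le_add_left (add_le_add_left hle _) _).trans ?_
  rw [← EReal.coe_toReal hξd (hbot _), ← EReal.coe_toReal hy (hbot _)]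
  rw [EReal.toReal_coe, EReal.toReal_coe]
  norm_cast
  linarith

/-- On a bounded time interval the drift is bounded above, as distances and potential are controlled
along the scheme. This one-sided bound supplies the monotone function for Lebesgue's theorem. -/
theorem exists_antitoneOn (ha : IsApproximation φ x₀ ξ P x h) (hbot : ∀ x, φ x ≠ ⊥)
    (hx₀ : x₀ ∈ domain φ) {lam C A B : ℝ} (hC : 0 ≤ C) (hB : 0 ≤ B) (hevi : OneStepEVI lam C φ)
    (hlow : ∀ z ∈ domain φ, -A - B * dist x₀ z ^ 2 ≤ (φ z).toReal) {y : X} (hy : y ∈ domain φ)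
    (T : ℝ) :
    ∃ L : ℝ, AntitoneOn (fun t => dist (ξ t) y ^ 2 - L * t) (Icc 0 T) := by
  obtain ⟨M, hM⟩ := ha.exists_lower_bound hbot hx₀ hC hB hevi hlow (T + 1)
  set R := 2 * dist x₀ y ^ 2 + 2 * (2 * ((φ x₀).toReal + M) * (T + 1)) with hR
  set L := |lam| * R + 2 * ((φ y).toReal + M) with hL
  refine ⟨L, fun s hs t ht hst => ?_⟩
  have hmain := ha.dist_sq_sub_le hbot hx₀ hC hevi hy hs.1 hst zero_lt_one (M := M) (L := L)
    (by filter_upwards [hM] with n hn k hk using hn k (by linarith [ht.2])) (by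
      filter_upwards [hM] with n hn k _ hk
      have h1 := hn k (by linarith [ht.2])
      have h2 := (ha.sol n).dist_sq_le hbot hx₀ k
      have h3 : dist (x n k) y ^ 2 ≤ R := by
        have h4 : dist (x n k) y ≤ dist x₀ (x n k) + dist x₀ y := by
          rw [dist_comm x₀ (x n k)]; exact dist_triangle _ _ _
        have h5 : dist (x n k) y ^ 2 ≤ (dist x₀ (x n k) + dist x₀ y) ^ 2 := by gcongr
        have h6 : 2 * ((φ x₀).toReal - (φ (x n k)).toReal) * (P n).pt k
            ≤ 2 * ((φ x₀).toReal + M) * (T + 1) := by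
          have := (ha.sol n).toReal_le hbot hx₀ k
          have := (P n).pt_nonneg k
          have := ht.2
          refine mul_le_mul ?_ ?_ ?_ ?_ <;> linarith
        rw [hR]
        linarith [sq_nonneg (dist x₀ (x n k) - dist x₀ y)]
      have h4 : -lam * dist (x n k) y ^ 2 ≤ |lam| * R :=
        mul_le_mul (neg_le_abs lam) h3 (sq_nonneg _) (abs_nonneg _)
      rw [hL]
      linarith)
  simp only
  linarith

theorem ae_evi (ha : IsApproximation φ x₀ ξ P x h) (hbot : ∀ x, φ x ≠ ⊥)
    (hlsc : LowerSemicontinuous φ)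
    (hx₀ : x₀ ∈ domain φ) {lam C A B : ℝ} (hC : 0 ≤ C) (hB : 0 ≤ B) (hevi : OneStepEVI lam C φ)
    (hlow : ∀ z ∈ domain φ, -A - B * dist x₀ z ^ 2 ≤ (φ z).toReal) {y : X} (hy : y ∈ domain φ) :
    ∀ᵐ t ∂(volume.restrict (Ioi (0 : ℝ))),
      ∃ v : ℝ, HasDerivAt (fun s : ℝ => dist (ξ s) y ^ 2) v t ∧
        ((1 / 2 * v : ℝ) : EReal) + ((lam / 2 * dist (ξ t) y ^ 2 : ℝ) : EReal) + φ (ξ t)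
          ≤ φ y := by
  rw [ae_restrict_iff' measurableSet_Ioi]
  have hdiff : ∀ᵐ t : ℝ, ∀ n : ℕ, t ∈ Ioo (0 : ℝ) n →
      DifferentiableAt ℝ (fun s : ℝ => dist (ξ s) y ^ 2) t := by
    refine ae_all_iff.2 fun n => ?_
    obtain ⟨L, hanti⟩ := ha.exists_antitoneOn hbot hx₀ hC hB hevi hlow hy n
    have hmono : MonotoneOn (fun t => -(dist (ξ t) y ^ 2 - L * t)) (Ioo 0 (n : ℝ)) :=
      hanti.neg.mono Ioo_subset_Icc_self
    filter_upwards [hmono.ae_differentiableWithinAt_of_mem] with t ht hmem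
    have h1 := ((ht hmem).differentiableAt (Ioo_mem_nhds hmem.1 hmem.2)).neg.add
      ((differentiableAt_id (𝕜 := ℝ) (x := t)).const_mul L)
    refine h1.congr_of_eventuallyEq (Eventually.of_forall fun s => ?_)
    simp
  filter_upwards [hdiff] with t ht ht0
  have ht0' : 0 < t := ht0
  obtain ⟨n, hn⟩ := exists_nat_gt t
  have hd := (ht n ⟨ht0, hn⟩).hasDerivAt
  refine ⟨_, hd, ?_⟩
  have hlim := ha.limsup_evi hbot hlsc hx₀ hC hB hevi hlow hy ht0'.le
  have hslope : Tendsto (fun ε : ℝ =>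
      (((dist (ξ (t + ε)) y ^ 2 - dist (ξ t) y ^ 2) / (2 * ε) : ℝ) : EReal)) (𝓝[>] 0)
      (𝓝 ((1 / 2 * deriv (fun s : ℝ => dist (ξ s) y ^ 2) t : ℝ) : EReal)) := by
    refine (continuous_coe_real_ereal.tendsto _).comp ?_
    have h1 := (hd.tendsto_slope_zero_right).const_mul (1 / 2)
    refine h1.congr fun ε => ?_
    simp only [smul_eq_mul]
    rw [div_eq_mul_inv _ (2 * ε), mul_inv]
    ring
  -- At a point of differentiability the limsup is half the derivative.
  rwa [hslope.limsup_eq] at hlim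

end IsApproximation

end EVIFlow

/-! ### First variation of the squared distance in CAT(1)-spaces -/

namespace EVIFlow

/-- The point of the unit sphere with the given coordinates. -/
def spherePoint (a b c : ℝ) (h : a ^ 2 + b ^ 2 + c ^ 2 = 1) : UnitSphere :=
  ⟨!₂[a, b, c], by simp [EuclideanSpace.norm_eq, Fin.sum_univ_three, h]⟩

theorem sphereDist_spherePoint {a b c a' b' c' : ℝ} (h : a ^ 2 + b ^ 2 + c ^ 2 = 1)
    (h' : a' ^ 2 + b' ^ 2 + c' ^ 2 = 1) :
    sphereDist (spherePoint a b c h) (spherePoint a' b' c' h')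
      = Real.arccos (a * a' + b * b' + c * c') := by
  have h1 : ‖((spherePoint a b c h : UnitSphere) : EuclideanSpace ℝ (Fin 3))‖ = 1 :=
    norm_eq_of_mem_sphere _
  have h2 : ‖((spherePoint a' b' c' h' : UnitSphere) : EuclideanSpace ℝ (Fin 3))‖ = 1 :=
    norm_eq_of_mem_sphere _
  rw [sphereDist, InnerProductGeometry.angle, h1, h2]
  congr 1
  simp [spherePoint, PiLp.inner_apply, Fin.sum_univ_three]
  ring

/-- The great circle arc in the horizontal plane, run through with speed `b`. -/
noncomputable def sphereArc (b t : ℝ) : UnitSphere :=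
  spherePoint (Real.cos (t * b)) (Real.sin (t * b)) 0 (by simp)

theorem sphereDist_sphereArc {b s t : ℝ} (hb : 0 ≤ b) (hbπ : b ≤ Real.pi)
    (hs : s ∈ Icc (0 : ℝ) 1) (ht : t ∈ Icc (0 : ℝ) 1) :
    sphereDist (sphereArc b s) (sphereArc b t) = |s - t| * b := by
  rw [sphereArc, sphereArc, sphereDist_spherePoint]
  have h1 : Real.cos (s * b) * Real.cos (t * b) + Real.sin (s * b) * Real.sin (t * b) + 0 * 0
      = Real.cos (|s - t| * b) := by
    rw [← abs_of_nonneg hb, ← abs_mul, abs_of_nonneg hb, Real.cos_abs, sub_mul, Real.cos_sub]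
    ring
  rw [h1, Real.arccos_cos (by positivity)]
  have h2 : |s - t| ≤ 1 := abs_le.2 ⟨by linarith [hs.1, ht.2], by linarith [hs.2, ht.1]⟩
  exact (mul_le_of_le_one_left hb h2).trans hbπ

theorem isMinimalGeodesic_sphereArc {b : ℝ} (hb : 0 ≤ b) (hbπ : b ≤ Real.pi) :
    IsMinimalGeodesic sphereDist (sphereArc b) (sphereArc b 0) (sphereArc b 1) := by
  refine ⟨rfl, rfl, fun s hs t ht => ?_⟩
  rw [sphereDist_sphereArc hb hbπ hs ht, sphereDist_sphereArc hb hbπ (by simp) (by simp)]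
  simp

variable {X : Type*} [MetricSpace X]

/-- The CAT(1) inequality in terms of the spherical law of cosines. -/
theorem IsCAT1.dist_le_arccos (hX : IsCAT1 X) (hdiam : ∀ x y : X, dist x y < Real.pi / 2)
    {x y z : X} (hyz : y ≠ z) {γ : ℝ → X} (hγ : IsMinimalGeodesic dist γ y z) {t : ℝ}
    (ht : t ∈ Icc (0 : ℝ) 1) :
    (Real.sin ((1 - t) * dist y z) * Real.cos (dist x y)
        + Real.sin (t * dist y z) * Real.cos (dist x z)) / Real.sin (dist y z) ≤ 1 ∧
    dist x (γ t) ≤ Real.arccos ((Real.sin ((1 - t) * dist y z) * Real.cos (dist x y)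
        + Real.sin (t * dist y z) * Real.cos (dist x z)) / Real.sin (dist y z)) := by
  have hπ := Real.pi_pos
  obtain ⟨b, hb⟩ : ∃ b, b = dist y z := ⟨_, rfl⟩
  obtain ⟨p, hp⟩ : ∃ p, p = dist x y := ⟨_, rfl⟩
  obtain ⟨q, hq⟩ : ∃ q, q = dist x z := ⟨_, rfl⟩
  have hb0 : 0 < b := hb ▸ dist_pos.2 hyz
  have hp0 : 0 ≤ p := hp ▸ dist_nonneg
  have hq0 : 0 ≤ q := hq ▸ dist_nonneg
  have hbπ : b < Real.pi / 2 := hb ▸ hdiam y z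
  have hpπ : p < Real.pi / 2 := hp ▸ hdiam x y
  have hqπ : q < Real.pi / 2 := hq ▸ hdiam x z
  have t1 : q ≤ p + b := by rw [hq, hp, hb]; exact dist_triangle _ _ _
  have t2 : p ≤ q + b := by rw [hq, hp, hb, dist_comm y z]; exact dist_triangle _ _ _
  have t3 : b ≤ p + q := by rw [hq, hp, hb, dist_comm x y]; exact dist_triangle _ _ _
  have hcomp := hX.2 x y z (by rw [dist_comm z x, ← hb, ← hp, ← hq]; linarith) γ hγ
  rw [dist_comm z x] at hcomp
  rw [← hb, ← hp, ← hq] at hcomp ⊢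
  have hsb : 0 < Real.sin b := Real.sin_pos_of_pos_of_lt_pi hb0 (by linarith)
  have hsp : 0 ≤ Real.sin p := Real.sin_nonneg_of_nonneg_of_le_pi hp0 (by linarith)
  -- The comparison triangle is explicit: `y'` and `z'` lie on the equator and `x' = (cos p, u, ·)`,
  -- where `u` is forced by `d(x', z') = q`. A third coordinate exists because `u² ≤ sin² p`, which
  -- is `cos(p+b) ≤ cos q ≤ cos(p-b)`, that is, the triangle inequalities.
  obtain ⟨u, hu⟩ : ∃ u, u = (Real.cos q - Real.cos p * Real.cos b) / Real.sin b := ⟨_, rfl⟩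
  have hub : u * Real.sin b = Real.cos q - Real.cos p * Real.cos b := by
    rw [hu]; exact div_mul_cancel₀ _ hsb.ne'
  have hup : u ^ 2 ≤ Real.sin p ^ 2 := by
    have c1 : Real.cos (p + b) ≤ Real.cos q :=
      Real.cos_le_cos_of_nonneg_of_le_pi hq0 (by linarith) t1
    have c2 : Real.cos q ≤ Real.cos (p - b) := by
      rw [← Real.cos_abs (p - b)]
      exact Real.cos_le_cos_of_nonneg_of_le_pi (abs_nonneg _) (by linarith)
        (abs_le.2 ⟨by linarith, by linarith⟩)
    rw [Real.cos_add] at c1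
    rw [Real.cos_sub] at c2
    refine sq_le_sq' ?_ ?_
    · refine le_of_mul_le_mul_right ?_ hsb
      linarith
    · refine le_of_mul_le_mul_right ?_ hsb
      linarith
  have hpy := Real.sin_sq_add_cos_sq p
  have hx' : Real.cos p ^ 2 + u ^ 2 + √(1 - Real.cos p ^ 2 - u ^ 2) ^ 2 = 1 := by
    rw [Real.sq_sqrt (by linarith)]; ring
  have hv : Real.cos p * Real.cos (t * b) + u * Real.sin (t * b)
      + √(1 - Real.cos p ^ 2 - u ^ 2) * 0
      = (Real.sin ((1 - t) * b) * Real.cos p + Real.sin (t * b) * Real.cos q) / Real.sin b := by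
    rw [eq_div_iff hsb.ne', sub_mul, one_mul, Real.sin_sub]
    linear_combination Real.sin (t * b) * hub
  have hkey := hcomp (spherePoint _ _ _ hx') (sphereArc b 0) (sphereArc b 1)
    (by
      rw [sphereArc, sphereDist_spherePoint]
      simp [Real.arccos_cos hp0 (by linarith)])
    (by
      rw [sphereDist_sphereArc hb0.le (by linarith) (by simp) (by simp)]
      simp)
    (by
      rw [sphereArc, sphereDist_spherePoint]
      have : Real.cos (1 * b) * Real.cos p + Real.sin (1 * b) * u
          + 0 * √(1 - Real.cos p ^ 2 - u ^ 2) = Real.cos q := by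
        rw [one_mul]; linear_combination hub
      rw [this, Real.arccos_cos hq0 (by linarith)])
    (sphereArc b) (isMinimalGeodesic_sphereArc hb0.le (by linarith)) t ht
  rw [sphereArc, sphereDist_spherePoint, hv] at hkey
  -- Since `arccos` is constant beyond `1`, the bound on its argument is recorded separately; it
  -- follows from Cauchy–Schwarz.
  refine ⟨?_, hkey⟩
  rw [← hv, mul_zero, add_zero]
  refine (abs_le_of_sq_le_sq' ?_ zero_le_one).2
  have h1 := Real.sin_sq_add_cos_sq (t * b)
  have h2 : Real.cos p ^ 2 + u ^ 2 ≤ 1 := by linarith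
  calc (Real.cos p * Real.cos (t * b) + u * Real.sin (t * b)) ^ 2
      ≤ (Real.cos p ^ 2 + u ^ 2) * (Real.sin (t * b) ^ 2 + Real.cos (t * b) ^ 2) := by
        nlinarith only [sq_nonneg (Real.cos p * Real.sin (t * b) - u * Real.cos (t * b))]
    _ ≤ 1 ^ 2 := by rw [h1, mul_one, one_pow]; exact h2

theorem sub_sin_le_cube {v : ℝ} (h0 : 0 ≤ v) (h1 : v < Real.pi / 2) :
    v - Real.sin v ≤ v ^ 3 / 2 := by
  have hc : 0 < Real.cos v := Real.cos_pos_of_mem_Ioo ⟨by linarith [Real.pi_pos], h1⟩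
  have h2 := Real.le_tan h0 h1
  rw [Real.tan_eq_sin_div_cos, le_div_iff₀ hc] at h2
  have h3 := mul_le_mul_of_nonneg_left (Real.one_sub_sq_div_two_le_cos (x := v)) h0
  linarith

/-- Expand `cos(b + u)` with `cos u ≥ 1 - u²/2` and `sin u ≤ u + u²`; for negative `u` the latter
uses `-u ≤ b < π/2 ≤ 2`. -/
theorem cos_taylor_lower {b c : ℝ} (hb0 : 0 ≤ b) (hb1 : b < Real.pi / 2) (hc0 : 0 ≤ c) :
    Real.cos b - (c - b) * Real.sin b - 3 / 2 * (c - b) ^ 2 ≤ Real.cos c := by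
  obtain ⟨u, hu⟩ : ∃ u, u = c - b := ⟨_, rfl⟩
  have hπ := Real.pi_pos
  have hπ4 := Real.pi_le_four
  have hcu : c = b + u := by rw [hu]; ring
  have hcb0 : 0 ≤ Real.cos b := Real.cos_nonneg_of_neg_pi_div_two_le_of_le (by linarith) hb1.le
  have hsb0 : 0 ≤ Real.sin b := Real.sin_nonneg_of_nonneg_of_le_pi hb0 (by linarith)
  have hs : Real.sin u ≤ u + u ^ 2 := by
    rcases le_total 0 u with h | h
    · linarith [Real.sin_le h, sq_nonneg u]
    · have h1 := sub_sin_le_cube (v := -u) (by linarith) (by linarith)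
      rw [Real.sin_neg] at h1
      have h2 : (-u) ^ 3 ≤ 2 * u ^ 2 := by
        have : 0 ≤ u ^ 2 * (2 + u) := mul_nonneg (sq_nonneg u) (by linarith)
        linarith
      linarith
  rw [← hu, hcu, Real.cos_add]
  have h1 := mul_le_mul_of_nonneg_left (Real.one_sub_sq_div_two_le_cos (x := u)) hcb0
  have h2 := mul_le_mul_of_nonneg_left hs hsb0
  have h3 := mul_le_mul_of_nonneg_right (Real.cos_le_one b) (sq_nonneg u)
  have h4 := mul_le_mul_of_nonneg_right (Real.sin_le_one b) (sq_nonneg u)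
  linarith

/-- The comparison of the first variation on the sphere with the squared side lengths. -/
theorem spherical_first_variation_le {a b c : ℝ} (ha0 : 0 < a) (ha1 : a < Real.pi / 2)
    (hb0 : 0 < b) (hb1 : b < Real.pi / 2) (hc0 : 0 ≤ c)
    (h1 : c ≤ b + a) (h2 : b ≤ c + a) :
    -(2 * (a / Real.sin a) * (b / Real.sin b) * (Real.cos c - Real.cos a * Real.cos b))
      ≤ c ^ 2 - b ^ 2 + 20 * a ^ 2 := by
  have hπ := Real.pi_pos
  have hπ4 := Real.pi_le_four
  have hsin : ∀ v : ℝ, 0 < v → v < Real.pi / 2 → v / 2 ≤ Real.sin v := by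
    intro v hv0 hv1
    refine le_trans ?_ (Real.mul_le_sin hv0.le hv1.le)
    rw [div_mul_eq_mul_div, div_le_div_iff₀ two_pos hπ]
    nlinarith
  have hsa := hsin a ha0 ha1
  have hsb := hsin b hb0 hb1
  have hsa0 : 0 < Real.sin a := by linarith
  have hsb0 : 0 < Real.sin b := by linarith
  obtain ⟨α, hα⟩ : ∃ α, α = a / Real.sin a := ⟨_, rfl⟩
  obtain ⟨β, hβ⟩ : ∃ β, β = b / Real.sin b := ⟨_, rfl⟩
  have hα1 : 1 ≤ α := by rw [hα, one_le_div hsa0]; exact Real.sin_le ha0.le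
  have hα2 : α ≤ 2 := by rw [hα, div_le_iff₀ hsa0]; linarith
  have hα3 : α - 1 ≤ a ^ 2 := by
    rw [hα, sub_le_iff_le_add, div_le_iff₀ hsa0]
    have := sub_sin_le_cube ha0.le ha1
    have := mul_le_mul_of_nonneg_left hsa (sq_nonneg a)
    linarith
  have hβ1 : 1 ≤ β := by rw [hβ, one_le_div hsb0]; exact Real.sin_le hb0.le
  have hβ2 : β ≤ 2 := by rw [hβ, div_le_iff₀ hsb0]; linarith
  have hβb : β * Real.sin b = b := by rw [hβ]; exact div_mul_cancel₀ _ hsb0.ne'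
  rw [← hα, ← hβ]
  obtain ⟨u, hu⟩ : ∃ u, u = c - b := ⟨_, rfl⟩
  have hu2 : u ^ 2 ≤ a ^ 2 := sq_le_sq' (by linarith) (by linarith)
  have hcb : 0 ≤ Real.cos b := Real.cos_nonneg_of_neg_pi_div_two_le_of_le (by linarith) hb1.le
  have hcos : -(u * Real.sin b) - 3 / 2 * u ^ 2 ≤ Real.cos c - Real.cos a * Real.cos b := by
    have t := cos_taylor_lower hb0.le hb1 hc0
    rw [← hu] at t
    have := mul_le_mul_of_nonneg_right (Real.cos_le_one a) hcb
    linarith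
  have hαβ0 : 0 ≤ 2 * α * β := by positivity
  have hmul := mul_le_mul_of_nonneg_left hcos hαβ0
  -- The leading term is `2bu`, with `u = c - b` and `|u| ≤ a`. The Taylor remainder costs `3αβu² ≤
  -- 12a²` and replacing `α` by `1` costs `8a²`, whence `20`.
  have e1 : 2 * α * β * (-(u * Real.sin b) - 3 / 2 * u ^ 2)
      = -(2 * α * u * b) - 3 * (α * β) * u ^ 2 := by
    linear_combination -(2 * α * u) * hβb
  have hαβ : α * β ≤ 4 := by nlinarith
  have e2 : α * β * u ^ 2 ≤ 4 * a ^ 2 := mul_le_mul hαβ hu2 (sq_nonneg u) (by norm_num)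
  have e3 : (2 * b * (α - 1)) * u ≤ 8 * a ^ 2 := by
    calc (2 * b * (α - 1)) * u ≤ (2 * b * (α - 1)) * a :=
          mul_le_mul_of_nonneg_left (by linarith)
            (mul_nonneg (by positivity) (by linarith))
      _ = 2 * b * a * (α - 1) := by ring
      _ ≤ 2 * b * a * a ^ 2 := mul_le_mul_of_nonneg_left hα3 (by positivity)
      _ ≤ 2 * 2 * 2 * a ^ 2 := by gcongr <;> linarith
      _ = 8 * a ^ 2 := by ring
  have e4 : c ^ 2 - b ^ 2 = 2 * b * u + u ^ 2 := by rw [hu]; ring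
  linarith [sq_nonneg u]

/-- The first variation of the squared distance from `x` along a geodesic from `z` to `y`. -/
theorem IsCAT1.eventually_slope_sq_dist_le (hX : IsCAT1 X)
    (hdiam : ∀ x y : X, dist x y < Real.pi / 2) {x y z : X} {γ : ℝ → X}
    (hγ : IsMinimalGeodesic dist γ z y) {δ : ℝ} (hδ : 0 < δ) :
    ∀ᶠ s in 𝓝[>] (0 : ℝ), (dist x (γ s) ^ 2 - dist x z ^ 2) / s
      ≤ dist x y ^ 2 - dist z y ^ 2 + 20 * dist x z ^ 2 + δ := by
  -- The cases `z = y` and `x = z` are separated: `sin b` would vanish in the first, and `arccos` is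
  -- not differentiable at `cos 0 = 1` in the second.
  rcases eq_or_ne z y with rfl | hzy
  · filter_upwards [Ioo_mem_nhdsGT (zero_lt_one' ℝ)] with s hs
    have h1 := hγ.2.2 0 (by simp) s ⟨hs.1.le, hs.2.le⟩
    rw [hγ.1, dist_self, mul_zero] at h1
    rw [← dist_eq_zero.1 h1, sub_self, zero_div, dist_self]
    have := sq_nonneg (dist x z)
    linarith
  rcases eq_or_ne x z with rfl | hxz
  · have hlim : Tendsto (fun s : ℝ => s * dist x y ^ 2) (𝓝[>] 0) (𝓝 (0 * dist x y ^ 2)) :=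
      Tendsto.mono_left (Continuous.tendsto (by fun_prop) 0) nhdsWithin_le_nhds
    rw [zero_mul] at hlim
    filter_upwards [Ioo_mem_nhdsGT (zero_lt_one' ℝ), hlim.eventually_le_const hδ] with s hs hs'
    have h1 := hγ.2.2 0 (by simp) s ⟨hs.1.le, hs.2.le⟩
    rw [hγ.1, zero_sub, abs_neg, abs_of_pos hs.1] at h1
    rw [h1, dist_self, div_le_iff₀ hs.1]
    have := mul_le_mul_of_nonneg_right hs' hs.1.le
    linarith
  have hπ := Real.pi_pos
  obtain ⟨a, ha⟩ : ∃ a, a = dist x z := ⟨_, rfl⟩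
  obtain ⟨b, hb⟩ : ∃ b, b = dist z y := ⟨_, rfl⟩
  obtain ⟨c, hc⟩ : ∃ c, c = dist x y := ⟨_, rfl⟩
  have ha0 : 0 < a := ha ▸ dist_pos.2 hxz
  have hb0 : 0 < b := hb ▸ dist_pos.2 hzy
  have hc0 : 0 ≤ c := hc ▸ dist_nonneg
  have ha1 : a < Real.pi / 2 := ha ▸ hdiam x z
  have hb1 : b < Real.pi / 2 := hb ▸ hdiam z y
  have t1 : c ≤ b + a := by
    rw [ha, hb, hc, add_comm]; exact dist_triangle _ _ _
  have t2 : b ≤ c + a := by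
    rw [ha, hb, hc, add_comm, dist_comm x z]; exact dist_triangle _ _ _
  have hsa : 0 < Real.sin a := Real.sin_pos_of_pos_of_lt_pi ha0 (by linarith)
  have hsb : 0 < Real.sin b := Real.sin_pos_of_pos_of_lt_pi hb0 (by linarith)
  have hcat := fun t ht => (hX.dist_le_arccos hdiam (x := x) hzy hγ (t := t) ht).2
  rw [← ha, ← hb, ← hc] at hcat ⊢
  set v : ℝ → ℝ := fun s =>
    (Real.sin ((1 - s) * b) * Real.cos a + Real.sin (s * b) * Real.cos c) / Real.sin b with hv
  have hv0 : v 0 = Real.cos a := by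
    simp only [hv, sub_zero, one_mul, zero_mul, Real.sin_zero, add_zero]
    exact mul_div_cancel_left₀ _ hsb.ne'
  have hvd : HasDerivAt v ((b / Real.sin b) * (Real.cos c - Real.cos a * Real.cos b)) 0 := by
    have d1 : HasDerivAt (fun s : ℝ => (1 - s) * b) (-b) 0 := by
      simpa using ((hasDerivAt_id (0 : ℝ)).const_sub 1).mul_const b
    have d2 : HasDerivAt (fun s : ℝ => s * b) b 0 := by
      simpa using (hasDerivAt_id (0 : ℝ)).mul_const b
    have d3 := ((d1.sin.mul_const (Real.cos a)).add (d2.sin.mul_const (Real.cos c))).div_const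
      (Real.sin b)
    refine d3.congr_deriv ?_
    simp only [sub_zero, one_mul, zero_mul, Real.cos_zero]
    ring
  have hca1 : Real.cos a < 1 := by
    have := Real.cos_lt_cos_of_nonneg_of_le_pi le_rfl (by linarith) ha0
    rwa [Real.cos_zero] at this
  have hca0 : 0 < Real.cos a := Real.cos_pos_of_mem_Ioo ⟨by linarith, ha1⟩
  have harc : Real.arccos (v 0) = a := by
    rw [hv0]; exact Real.arccos_cos ha0.le (by linarith)
  have hsqrt : √(1 - v 0 ^ 2) = Real.sin a := by
    rw [hv0, ← Real.sin_sq, Real.sqrt_sq hsa.le]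
  have hH : HasDerivAt (fun s => Real.arccos (v s) ^ 2)
      (-(2 * (a / Real.sin a) * (b / Real.sin b) * (Real.cos c - Real.cos a * Real.cos b))) 0 := by
    have d1 := (Real.hasDerivAt_arccos (x := v 0) (by rw [hv0]; linarith)
      (by rw [hv0]; exact hca1.ne)).comp 0 hvd
    have d2 := d1.pow 2
    refine d2.congr_deriv ?_
    rw [hsqrt]
    simp only [Function.comp_apply, harc]
    push_cast
    ring
  have hle := spherical_first_variation_le ha0 ha1 hb0 hb1 hc0 t1 t2
  have hslope := hH.tendsto_slope_zero_right.eventually_le_const (hle.trans_lt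
    (lt_add_of_pos_right _ hδ))
  filter_upwards [hslope, Ioo_mem_nhdsGT (zero_lt_one' ℝ)] with s hs hs01
  -- Comparison is an equality at `s = 0`, so it passes to the difference quotients.
  refine le_trans ?_ hs
  rw [zero_add, harc, smul_eq_mul, ← div_eq_inv_mul]
  have hd := hcat s ⟨hs01.1.le, hs01.2.le⟩
  have h3 : dist x (γ s) ^ 2 ≤ Real.arccos (v s) ^ 2 := by gcongr
  have := hs01.1
  gcongr

theorem IsCAT1.oneStepEVI (hX : IsCAT1 X) (hdiam : ∀ x y : X, dist x y < Real.pi / 2)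
    {φ : X → EReal} {lam : ℝ} (hbot : ∀ x, φ x ≠ ⊥) (hconv : IsLambdaConvex lam φ) :
    OneStepEVI lam 20 φ := by
  intro x hx τ hτ z hz y hy
  obtain ⟨γ, hγ, hγc⟩ := hconv z (mem_domain_of_mem_minimizerSet hz hy) y hy
  have := slope_le_of_mem_minimizerSet hbot hτ hz hy hγ.1 hγ.2.1 hγc
    (fun δ hδ => hX.eventually_slope_sq_dist_le hdiam hγ hδ)
  linarith

end EVIFlow

/-! ### Midpoint convexity, existence of minimizers and lower bounds -/

namespace EVIFlow

/-- Convexity of `s ↦ cos √s`, at midpoints. -/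
theorem two_mul_cos_sqrt_le {p q : ℝ} (hp0 : 0 ≤ p) (hp1 : p ≤ Real.pi / 2) (hq0 : 0 ≤ q)
    (hq1 : q ≤ Real.pi / 2) :
    2 * Real.cos √((p ^ 2 + q ^ 2) / 2) ≤ Real.cos p + Real.cos q := by
  have hπ := Real.pi_pos
  set r := √((p ^ 2 + q ^ 2) / 2) with hr
  have hr2 : r ^ 2 = (p ^ 2 + q ^ 2) / 2 := Real.sq_sqrt (by positivity)
  have hr0 : 0 ≤ r := Real.sqrt_nonneg _
  have hr1 : r ≤ Real.pi / 2 := by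
    refine abs_le_of_sq_le_sq' ?_ (by positivity) |>.2
    have h1 : p ^ 2 ≤ (Real.pi / 2) ^ 2 := by gcongr
    have h2 : q ^ 2 ≤ (Real.pi / 2) ^ 2 := by gcongr
    linarith
  rcases hr0.eq_or_lt with h0 | hrpos
  · rw [← h0] at hr2
    have hp : p = 0 := by
      refine pow_eq_zero_iff two_ne_zero |>.1 (le_antisymm ?_ (sq_nonneg p))
      linarith [sq_nonneg q]
    have hq : q = 0 := by
      refine pow_eq_zero_iff two_ne_zero |>.1 (le_antisymm ?_ (sq_nonneg q))
      linarith [sq_nonneg p]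
    rw [← h0, hp, hq, Real.cos_zero]
    norm_num
  -- In the variable `w²` this is the tangent line to the cosine at `r`: as `sin w / w` decreases,
  -- `cos w + (S/2) w²` is minimal at `w = r`. Adding the values at `p` and `q` removes the
  -- quadratic terms since `p² + q² = 2r²`.
  set S := Real.sin r / r with hS
  have hSr : S * r = Real.sin r := div_mul_cancel₀ _ hrpos.ne'
  have hsinc : ∀ u v : ℝ, 0 ≤ u → u ≤ v → v ≤ Real.pi / 2 → u * Real.sin v ≤ v * Real.sin u := by
    intro u v hu huv hv
    rcases (hu.trans huv).eq_or_lt with h | hv0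
    · rw [← h, Real.sin_zero, mul_zero, zero_mul]
    have hconc : (1 - u / v) • Real.sin 0 + (u / v) • Real.sin v
        ≤ Real.sin ((1 - u / v) • 0 + (u / v) • v) :=
      strictConcaveOn_sin_Icc.concaveOn.2 ⟨le_rfl, hπ.le⟩ ⟨hv0.le, by linarith⟩
        (sub_nonneg.2 ((div_le_one hv0).2 huv)) (by positivity) (by ring)
    simp only [smul_eq_mul, mul_zero, zero_add, Real.sin_zero] at hconc
    rw [div_mul_cancel₀ _ hv0.ne', div_mul_eq_mul_div, div_le_iff₀ hv0] at hconc
    linarith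
  have hd : ∀ w : ℝ, HasDerivAt (fun w => Real.cos w + S / 2 * w ^ 2) (-Real.sin w + S * w) w := by
    intro w
    refine ((Real.hasDerivAt_cos w).add ((hasDerivAt_pow 2 w).const_mul (S / 2))).congr_deriv ?_
    push_cast
    ring
  have hcont : Continuous fun w : ℝ => Real.cos w + S / 2 * w ^ 2 := by fun_prop
  have hmin : ∀ w, 0 ≤ w → w ≤ Real.pi / 2 →
      Real.cos r + S / 2 * r ^ 2 ≤ Real.cos w + S / 2 * w ^ 2 := by
    intro w hw0 hw1
    rcases le_total w r with hwr | hwr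
    · have hanti : AntitoneOn (fun w => Real.cos w + S / 2 * w ^ 2) (Icc 0 r) := by
        refine antitoneOn_of_deriv_nonpos (convex_Icc _ _) hcont.continuousOn
          (fun w _ => (hd w).differentiableAt.differentiableWithinAt) fun w hw => ?_
        rw [interior_Icc] at hw
        rw [(hd w).deriv]
        have := hsinc w r hw.1.le hw.2.le hr1
        refine le_of_mul_le_mul_left (a := r) ?_ hrpos
        linear_combination this + w * hSr
      exact hanti ⟨hw0, hwr⟩ ⟨hr0, le_rfl⟩ hwr
    · have hmono : MonotoneOn (fun w => Real.cos w + S / 2 * w ^ 2) (Icc r (Real.pi / 2)) := by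
        refine monotoneOn_of_deriv_nonneg (convex_Icc _ _) hcont.continuousOn
          (fun w _ => (hd w).differentiableAt.differentiableWithinAt) fun w hw => ?_
        rw [interior_Icc] at hw
        rw [(hd w).deriv]
        have := hsinc r w hr0 hw.1.le hw.2.le
        refine le_of_mul_le_mul_left (a := r) ?_ hrpos
        linear_combination this - w * hSr
      exact hmono ⟨le_rfl, hr1⟩ ⟨hwr, hw1⟩ hwr
  have h1 := hmin p hp0 hp1
  have h2 := hmin q hq0 hq1
  linear_combination h1 + h2 - S * hr2

/-- Uniform convexity of the squared distance on small balls of the sphere, at midpoints. -/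
theorem sq_le_of_cos_midpoint {p q m b D : ℝ} (hD : D < Real.pi / 2) (hp0 : 0 ≤ p) (hp : p ≤ D)
    (hq0 : 0 ≤ q) (hq : q ≤ D) (hm0 : 0 ≤ m) (hm : m ≤ D) (hb0 : 0 ≤ b) (hb : b ≤ D)
    (h : Real.cos p + Real.cos q ≤ 2 * Real.cos (b / 2) * Real.cos m) :
    m ^ 2 ≤ (p ^ 2 + q ^ 2) / 2 - Real.cos D / Real.pi ^ 2 * b ^ 2 := by
  have hπ := Real.pi_pos
  set r := √((p ^ 2 + q ^ 2) / 2) with hr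
  have hr2 : r ^ 2 = (p ^ 2 + q ^ 2) / 2 := Real.sq_sqrt (by positivity)
  have hr0 : 0 ≤ r := Real.sqrt_nonneg _
  have hD0 : 0 ≤ D := hp0.trans hp
  have hr1 : r ≤ D := by
    refine abs_le_of_sq_le_sq' ?_ hD0 |>.2
    have h1 : p ^ 2 ≤ D ^ 2 := by gcongr
    have h2 : q ^ 2 ≤ D ^ 2 := by gcongr
    linarith
  have hconv := two_mul_cos_sqrt_le hp0 (hp.trans hD.le) hq0 (hq.trans hD.le)
  rw [← hr] at hconv
  have hcD : 0 < Real.cos D := Real.cos_pos_of_mem_Ioo ⟨by linarith, hD⟩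
  have hcm : Real.cos D ≤ Real.cos m := Real.cos_le_cos_of_nonneg_of_le_pi hm0 (by linarith) hm
  have hb2 : Real.cos (b / 2) ≤ 1 - 2 / Real.pi ^ 2 * (b / 2) ^ 2 :=
    Real.cos_le_one_sub_mul_cos_sq (abs_le.2 ⟨by linarith, by linarith⟩)
  -- The deficit `1 - cos(b/2)`, quadratic in `b`, is multiplied by `cos m ≥ cos D > 0`; this is
  -- where a diameter strictly below `π/2` enters.
  have hgap : Real.cos D / Real.pi ^ 2 * b ^ 2 / 2 ≤ Real.cos m - Real.cos r := by
    have h1 := mul_le_mul_of_nonneg_right hb2 (hcD.le.trans hcm)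
    have h2 : Real.cos D * (2 / Real.pi ^ 2 * (b / 2) ^ 2)
        ≤ Real.cos m * (2 / Real.pi ^ 2 * (b / 2) ^ 2) :=
      mul_le_mul_of_nonneg_right hcm (by positivity)
    have h3 : Real.cos D * (2 / Real.pi ^ 2 * (b / 2) ^ 2)
        = Real.cos D / Real.pi ^ 2 * b ^ 2 / 2 := by ring
    rw [← h3]
    linarith
  have hgap0 : 0 ≤ Real.cos D / Real.pi ^ 2 * b ^ 2 / 2 := by positivity
  have hmr : m ≤ r := by
    by_contra hlt
    have := Real.cos_lt_cos_of_nonneg_of_le_pi hr0 (by linarith) (not_le.1 hlt)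
    linarith
  have hdiff : Real.cos m - Real.cos r ≤ (r ^ 2 - m ^ 2) / 2 := by
    have h1 := Real.cos_sub_cos m r
    have h2 : Real.sin ((m - r) / 2) = -Real.sin ((r - m) / 2) := by
      rw [← Real.sin_neg]; congr 1; ring
    rw [h2] at h1
    have s1 : Real.sin ((m + r) / 2) ≤ (m + r) / 2 := Real.sin_le (by linarith)
    have s2 : Real.sin ((r - m) / 2) ≤ (r - m) / 2 := Real.sin_le (by linarith)
    have s3 : 0 ≤ Real.sin ((r - m) / 2) :=
      Real.sin_nonneg_of_nonneg_of_le_pi (by linarith) (by linarith)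
    have := mul_le_mul s1 s2 s3 (by linarith)
    linarith
  linarith

variable {X : Type*} [MetricSpace X] {φ : X → EReal}

theorem IsCAT1.sq_dist_midpoint_le (hX : IsCAT1 X) {D : ℝ} (hD : D < Real.pi / 2)
    (hdiam : ∀ x y : X, dist x y ≤ D) (x : X) {y z : X} {γ : ℝ → X}
    (hγ : IsMinimalGeodesic dist γ y z) :
    dist x (γ (1 / 2)) ^ 2 ≤ (dist x y ^ 2 + dist x z ^ 2) / 2
      - Real.cos D / Real.pi ^ 2 * dist y z ^ 2 := by
  have hπ := Real.pi_pos
  rcases eq_or_ne y z with rfl | hyz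
  · have h1 := hγ.2.2 0 (by simp) (1 / 2) ⟨by norm_num, by norm_num⟩
    rw [hγ.1, dist_self, mul_zero] at h1
    rw [← dist_eq_zero.1 h1, dist_self]
    linarith
  have hb0 : 0 < dist y z := dist_pos.2 hyz
  have hbD := hdiam y z
  obtain ⟨h1, h2⟩ := hX.dist_le_arccos (fun x y => (hdiam x y).trans_lt hD) (x := x) hyz hγ
    (t := 1 / 2) ⟨by norm_num, by norm_num⟩
  refine sq_le_of_cos_midpoint hD dist_nonneg (hdiam _ _) dist_nonneg (hdiam _ _) dist_nonneg
    (hdiam _ _) dist_nonneg hbD ?_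
  set v := (Real.sin ((1 - 1 / 2) * dist y z) * Real.cos (dist x y)
        + Real.sin (1 / 2 * dist y z) * Real.cos (dist x z)) / Real.sin (dist y z) with hv
  have hs2 : 0 < Real.sin (dist y z / 2) :=
    Real.sin_pos_of_pos_of_lt_pi (by linarith) (by linarith)
  have hc2 : 0 < Real.cos (dist y z / 2) :=
    Real.cos_pos_of_mem_Ioo ⟨by linarith, by linarith⟩
  have hs : Real.sin (dist y z) = 2 * Real.sin (dist y z / 2) * Real.cos (dist y z / 2) := by
    rw [← Real.sin_two_mul]; congr 1; ring
  have hv' : 2 * Real.cos (dist y z / 2) * v = Real.cos (dist x y) + Real.cos (dist x z) := by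
    rw [hv, hs, show (1 - 1 / 2) * dist y z = dist y z / 2 by ring,
      show 1 / 2 * dist y z = dist y z / 2 by ring]
    field_simp
  rw [← hv']
  refine mul_le_mul_of_nonneg_left ?_ (by positivity)
  have h3 : Real.cos (Real.arccos v) ≤ Real.cos (dist x (γ (1 / 2))) :=
    Real.cos_le_cos_of_nonneg_of_le_pi dist_nonneg (Real.arccos_le_pi _) h2
  refine le_trans ?_ h3
  -- For `v < -1` the function `arccos` is truncated, but then `v` is below every cosine.
  rcases le_total (-1) v with hv1 | hv1
  · rw [Real.cos_arccos hv1 h1]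
  · exact hv1.trans (Real.neg_one_le_cos _)

/-- A lower semicontinuous semi-convex function on a bounded space is bounded below. -/
theorem IsLambdaConvex.exists_lower_bound {lam D : ℝ} (hbot : ∀ x, φ x ≠ ⊥)
    (hlsc : LowerSemicontinuous φ) (hconv : IsLambdaConvex lam φ)
    (hdiam : ∀ x y : X, dist x y ≤ D) {x₀ : X} (hx₀ : x₀ ∈ domain φ) :
    ∃ A : ℝ, ∀ z ∈ domain φ, -A ≤ (φ z).toReal := by
  have hD0 : 0 ≤ D := dist_nonneg.trans (hdiam x₀ x₀)
  have h1 : (((φ x₀).toReal - 1 : ℝ) : EReal) < φ x₀ := by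
    conv_rhs => rw [← EReal.coe_toReal hx₀ (hbot _)]
    exact_mod_cast sub_lt_self _ one_pos
  obtain ⟨r, hr, hball⟩ := Metric.eventually_nhds_iff.1 (hlsc x₀ _ h1)
  -- The fraction `t` does not depend on `z`: every geodesic from `x₀` is still in the ball of
  -- radius `r` at time `t`. Convexity extrapolates the local bound `φ x₀ - 1` to the endpoint, at
  -- cost `1 / t`.
  set t := min (r / (D + 1) / 2) (1 / 2) with ht
  have ht0 : 0 < t := by positivity
  have ht1 : t ≤ 1 / 2 := min_le_right _ _
  have htD : t * D < r := by
    have h2 : t * (D + 1) ≤ r / 2 := by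
      calc t * (D + 1) ≤ r / (D + 1) / 2 * (D + 1) :=
            mul_le_mul_of_nonneg_right (min_le_left _ _) (by positivity)
        _ = r / 2 := by field_simp
    linarith
  refine ⟨-(φ x₀).toReal + 1 / t + |lam| / 2 * D ^ 2, fun z hz => ?_⟩
  obtain ⟨γ, hγ, hc⟩ := hconv x₀ hx₀ z hz
  have htI : t ∈ Icc (0 : ℝ) 1 := ⟨ht0.le, by linarith⟩
  obtain ⟨hd, hle⟩ := hc.real_le hbot (hγ.1 ▸ hx₀) (hγ.2.1 ▸ hz) htI
  rw [hγ.1, hγ.2.1] at hle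
  have hdist : dist (γ t) x₀ < r := by
    have h3 := hγ.2.2 t htI 0 (by simp)
    rw [hγ.1, sub_zero, abs_of_pos ht0] at h3
    rw [h3]
    exact (mul_le_mul_of_nonneg_left (hdiam _ _) ht0.le).trans_lt htD
  have h4 : (((φ x₀).toReal - 1 : ℝ) : EReal) < φ (γ t) := hball hdist
  rw [← EReal.coe_toReal hd (hbot _)] at h4
  have h5 : (φ x₀).toReal - 1 < (φ (γ t)).toReal := by exact_mod_cast h4
  have h6 : -(lam / 2 * (1 - t) * dist x₀ z ^ 2) ≤ |lam| / 2 * D ^ 2 := by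
    have h7 : dist x₀ z ^ 2 ≤ D ^ 2 := by have := hdiam x₀ z; gcongr
    have h8 : (1 - t) * dist x₀ z ^ 2 ≤ 1 * D ^ 2 :=
      mul_le_mul (by linarith) h7 (sq_nonneg _) zero_le_one
    have h9 : -lam * ((1 - t) * dist x₀ z ^ 2) ≤ |lam| * (1 * D ^ 2) :=
      mul_le_mul (neg_le_abs lam) h8 (mul_nonneg (by linarith) (sq_nonneg _)) (abs_nonneg _)
    linarith
  refine le_of_mul_le_mul_left ?_ ht0
  have h10 := mul_le_mul_of_nonneg_left h6 ht0.le
  have h11 : t * (1 / t) = 1 := mul_one_div_cancel ht0.ne'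
  linear_combination hle + h5 + h10 - h11

/-- Existence of minimizers from uniform midpoint convexity of the squared distance. -/
theorem exists_mem_minimizerSet [CompleteSpace X] {lam k A : ℝ} (hbot : ∀ x, φ x ≠ ⊥)
    (hlsc : LowerSemicontinuous φ) (hconv : IsLambdaConvex lam φ) (hne : (domain φ).Nonempty)
    (hlow : ∀ z ∈ domain φ, -A ≤ (φ z).toReal)
    (hmid : ∀ (x y z : X) (γ : ℝ → X), IsMinimalGeodesic dist γ y z →
      dist x (γ (1 / 2)) ^ 2 ≤ (dist x y ^ 2 + dist x z ^ 2) / 2 - k * dist y z ^ 2)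
    {τ : ℝ} (hτ : 0 < τ) (hτk : 2 * τ * (1 + |lam|) ≤ k) (x : X) :
    (minimizerSet φ τ x).Nonempty := by
  set F : X → ℝ := fun z => (φ z).toReal + dist x z ^ 2 / (2 * τ) with hF
  -- For small `τ` the convexity of `d²/(2τ)` outweighs a negative `λ`, so near-minimal points are
  -- close together and minimizing sequences are Cauchy.
  have hFle : ∀ y ∈ domain φ, ∀ z ∈ domain φ, ∃ m ∈ domain φ,
      F m ≤ (F y + F z) / 2 - dist y z ^ 2 / 2 := by
    intro y hy z hz
    obtain ⟨γ, hγ, hc⟩ := hconv y hy z hz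
    obtain ⟨hd, hle⟩ := hc.real_le hbot (hγ.1 ▸ hy) (hγ.2.1 ▸ hz) (t := 1 / 2)
      ⟨by norm_num, by norm_num⟩
    rw [hγ.1, hγ.2.1] at hle
    refine ⟨_, hd, ?_⟩
    have h1 := hmid x y z γ hγ
    have h2 : (2 * τ * (1 + |lam|)) * dist y z ^ 2 ≤ k * dist y z ^ 2 :=
      mul_le_mul_of_nonneg_right hτk (sq_nonneg _)
    have h3 : dist x (γ (1 / 2)) ^ 2 / (2 * τ)
        ≤ ((dist x y ^ 2 + dist x z ^ 2) / 2 - (2 * τ * (1 + |lam|)) * dist y z ^ 2) / (2 * τ) := by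
      gcongr
      linarith
    have h4 : ((dist x y ^ 2 + dist x z ^ 2) / 2 - (2 * τ * (1 + |lam|)) * dist y z ^ 2) / (2 * τ)
        = (dist x y ^ 2 / (2 * τ) + dist x z ^ 2 / (2 * τ)) / 2
          - (1 + |lam|) * dist y z ^ 2 := by
      field_simp
    have h5 : -lam * dist y z ^ 2 ≤ |lam| * dist y z ^ 2 :=
      mul_le_mul_of_nonneg_right (neg_le_abs lam) (sq_nonneg _)
    have h6 : 0 ≤ |lam| * dist y z ^ 2 := by positivity
    simp only [hF]
    linarith [sq_nonneg (dist y z)]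
  have hbdd : BddBelow (F '' domain φ) := by
    refine ⟨-A, ?_⟩
    rintro _ ⟨z, hz, rfl⟩
    have : 0 ≤ dist x z ^ 2 / (2 * τ) := by positivity
    have := hlow z hz
    simp only [hF]
    linarith
  set I := sInf (F '' domain φ) with hI
  have hIle : ∀ z ∈ domain φ, I ≤ F z := fun z hz => csInf_le hbdd ⟨z, hz, rfl⟩
  have hseq : ∀ n : ℕ, ∃ z ∈ domain φ, F z < I + 1 / ((n : ℝ) + 1) := by
    intro n
    obtain ⟨_, ⟨z, hz, rfl⟩, hlt⟩ := exists_lt_of_csInf_lt (hne.image F)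
      (lt_add_of_pos_right I (by positivity : (0 : ℝ) < 1 / ((n : ℝ) + 1)))
    exact ⟨z, hz, hlt⟩
  choose z hz hzI using hseq
  have hto : Tendsto (fun n : ℕ => 1 / ((n : ℝ) + 1)) atTop (𝓝 0) :=
    tendsto_one_div_add_atTop_nhds_zero_nat
  have hcauchy : CauchySeq z := by
    refine cauchySeq_of_le_tendsto_0 (fun n : ℕ => √(2 * (1 / ((n : ℝ) + 1)))) ?_ ?_
    · intro n m N hn hm
      refine Real.le_sqrt_of_sq_le ?_
      obtain ⟨w, hw, hle⟩ := hFle _ (hz n) _ (hz m)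
      have h1 := hIle w hw
      have h2 : 1 / ((n : ℝ) + 1) ≤ 1 / ((N : ℝ) + 1) := by gcongr
      have h3 : 1 / ((m : ℝ) + 1) ≤ 1 / ((N : ℝ) + 1) := by gcongr
      have := hzI n
      have := hzI m
      linarith
    · have := (hto.const_mul 2).sqrt
      rwa [mul_zero, Real.sqrt_zero] at this
  obtain ⟨p, hp⟩ := cauchySeq_tendsto_of_complete hcauchy
  have hφp : φ p ≤ ((I - dist x p ^ 2 / (2 * τ) : ℝ) : EReal) := by
    refine EReal.ge_of_forall_gt_iff_ge.1 fun c hc => ?_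
    have h1 : ∀ᶠ n : ℕ in atTop, c ≤ I + 1 / ((n : ℝ) + 1) - dist x (z n) ^ 2 / (2 * τ) := by
      filter_upwards [hp.eventually (hlsc p c hc)] with n hn
      rw [← EReal.coe_toReal (hz n) (hbot _)] at hn
      have h2 : c < (φ (z n)).toReal := by exact_mod_cast hn
      have h3 := hzI n
      simp only [hF] at h3
      linarith
    have h4 : Tendsto (fun n : ℕ => I + 1 / ((n : ℝ) + 1) - dist x (z n) ^ 2 / (2 * τ)) atTop
        (𝓝 (I + 0 - dist x p ^ 2 / (2 * τ))) :=
      (hto.const_add I).sub (((tendsto_const_nhds.dist hp).pow 2).div_const _)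
    rw [add_zero] at h4
    exact_mod_cast ge_of_tendsto h4 h1
  have hpd : p ∈ domain φ := fun htop => by
    rw [htop, top_le_iff] at hφp
    exact EReal.coe_ne_top _ hφp
  refine ⟨p, mem_minimizerSet_of_toReal_le hbot hpd fun y hy => ?_⟩
  rw [← EReal.coe_toReal hpd (hbot _)] at hφp
  have h1 : (φ p).toReal ≤ I - dist x p ^ 2 / (2 * τ) := by exact_mod_cast hφp
  have h2 := hIle y hy
  simp only [hF] at h2
  linarith

/-- One finite value of `φ_τ` at `x₀`, here at half the threshold, already gives a quadratic lower
bound. -/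
theorem IsCoercive.exists_lower_bound (h : IsCoercive φ) (hbot : ∀ x, φ x ≠ ⊥) (x₀ : X) :
    ∃ A B : ℝ, 0 ≤ B ∧ ∀ z ∈ domain φ, -A - B * dist x₀ z ^ 2 ≤ (φ z).toReal := by
  obtain ⟨τ, hτ, hc⟩ := h
  obtain ⟨c, -, hlt⟩ := EReal.lt_iff_exists_real_btwn.1
    (hc x₀ (τ / 2) (half_pos hτ) (half_lt_self hτ)).1
  refine ⟨-c, 1 / (2 * (τ / 2)), by positivity, fun z hz => ?_⟩
  have h1 : (c : EReal) ≤ φ z + ((dist x₀ z ^ 2 / (2 * (τ / 2)) : ℝ) : EReal) :=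
    hlt.le.trans (iInf_le _ z)
  rw [← EReal.coe_toReal hz (hbot z)] at h1
  have h2 : c ≤ (φ z).toReal + dist x₀ z ^ 2 / (2 * (τ / 2)) := by exact_mod_cast h1
  rw [one_div_mul_eq_div]
  linarith

/-- The data needed by the construction of the flow are available in both settings. -/
theorem exists_oneStepEVI_and_lower_bound [CompleteSpace X] {lam : ℝ} (hbot : ∀ x, φ x ≠ ⊥)
    (hlsc : LowerSemicontinuous φ)
    (hcase : (IsCAT1 X ∧ Metric.ediam (Set.univ : Set X) < ENNReal.ofReal (Real.pi / 2) ∧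
        IsLambdaConvex lam φ) ∨
      (IsCoercive φ ∧ ∃ (K : ℝ) (Γ : Set (ℝ → X)), IsAdmissibleFamily lam K φ Γ))
    {x₀ : X} (hx₀ : x₀ ∈ domain φ) :
    ∃ C A B δ : ℝ, 0 ≤ C ∧ 0 ≤ B ∧ 0 < δ ∧ OneStepEVI lam C φ ∧
      (∀ z ∈ domain φ, -A - B * dist x₀ z ^ 2 ≤ (φ z).toReal) ∧
      ∀ x ∈ domain φ, ∀ τ : ℝ, 0 < τ → τ < δ → (minimizerSet φ τ x).Nonempty := by
  rcases hcase with ⟨hX, hdiam, hconv⟩ | ⟨hcoer, K, Γ, hΓ⟩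
  · have hπ := Real.pi_pos
    have hfin : Metric.ediam (Set.univ : Set X) ≠ ⊤ := ne_top_of_lt hdiam
    set D := (Metric.ediam (Set.univ : Set X)).toReal with hDdef
    have hD : D < Real.pi / 2 := (ENNReal.lt_ofReal_iff_toReal_lt hfin).1 hdiam
    have hdist : ∀ x y : X, dist x y ≤ D := fun x y => by
      rw [dist_edist]
      exact ENNReal.toReal_mono hfin (Metric.edist_le_ediam_of_mem (mem_univ x) (mem_univ y))
    have hD0 : 0 ≤ D := ENNReal.toReal_nonneg
    obtain ⟨A, hA⟩ := hconv.exists_lower_bound hbot hlsc hdist hx₀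
    have hcD : 0 < Real.cos D := Real.cos_pos_of_mem_Ioo ⟨by linarith, hD⟩
    set k := Real.cos D / Real.pi ^ 2 with hk
    have hk0 : 0 < k := by positivity
    refine ⟨20, A, 0, k / (2 * (1 + |lam|)), by norm_num, le_rfl, by positivity,
      hX.oneStepEVI (fun x y => (hdist x y).trans_lt hD) hbot hconv,
      fun z hz => by simpa using hA z hz, fun x _ τ hτ0 hτ => ?_⟩
    refine exists_mem_minimizerSet hbot hlsc hconv ⟨x₀, hx₀⟩ hA
      (fun x y z γ hγ => hX.sq_dist_midpoint_le hD hdist x hγ) hτ0 ?_ x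
    rw [lt_div_iff₀ (by positivity)] at hτ
    linarith
  · obtain ⟨A, B, hB, hlow⟩ := hcoer.exists_lower_bound hbot x₀
    obtain ⟨τ, hτ, hc⟩ := hcoer
    exact ⟨|K| / 2, A, B, τ, by positivity, hB, hτ, hΓ.oneStepEVI hbot, hlow,
      fun x _ σ h0 h1 => (hc x σ h0 h1).2⟩

end EVIFlow

theorem theorem4p5 {X : Type*} [MetricSpace X] [CompleteSpace X] (lam : ℝ) (φ : X → EReal)
    (hφ_bot : ∀ x, φ x ≠ ⊥) (hφ_lsc : LowerSemicontinuous φ)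
    (hcase :
      (EVIFlow.IsCAT1 X ∧ Metric.ediam (Set.univ : Set X) < ENNReal.ofReal (Real.pi / 2) ∧
        EVIFlow.IsLambdaConvex lam φ) ∨
      (EVIFlow.IsCoercive φ ∧
        ∃ (K : ℝ) (Γ : Set (ℝ → X)), EVIFlow.IsAdmissibleFamily lam K φ Γ))
    (x₀ : X) (hx₀ : x₀ ∈ EVIFlow.domain φ) :
    EVIFlow.IsGradientCurve φ x₀ (fun t => EVIFlow.gradientFlow φ t x₀) ∧
    (∀ t : ℝ, 0 ≤ t → EVIFlow.gradientFlow φ t x₀ ∈ EVIFlow.domain φ) ∧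
    (∀ y ∈ EVIFlow.domain φ, ∀ t : ℝ, 0 < t →
      Filter.limsup (fun ε : ℝ =>
          (((dist (EVIFlow.gradientFlow φ (t + ε) x₀) y ^ 2
              - dist (EVIFlow.gradientFlow φ t x₀) y ^ 2) / (2 * ε) : ℝ) : EReal))
          (nhdsWithin 0 (Set.Ioi 0))
        + ((lam / 2 * dist (EVIFlow.gradientFlow φ t x₀) y ^ 2 : ℝ) : EReal)
        + φ (EVIFlow.gradientFlow φ t x₀) ≤ φ y) ∧
    (∀ y ∈ EVIFlow.domain φ,
      ∀ᵐ t ∂(MeasureTheory.volume.restrict (Set.Ioi (0 : ℝ))),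
        ∃ v : ℝ, HasDerivAt (fun s : ℝ => dist (EVIFlow.gradientFlow φ s x₀) y ^ 2) v t ∧
          ((1 / 2 * v : ℝ) : EReal)
            + ((lam / 2 * dist (EVIFlow.gradientFlow φ t x₀) y ^ 2 : ℝ) : EReal)
            + φ (EVIFlow.gradientFlow φ t x₀) ≤ φ y) := by
  obtain ⟨C, A, B, δ, hC, hB, hδ, hevi, hlow, hmin⟩ :=
    EVIFlow.exists_oneStepEVI_and_lower_bound hφ_bot hφ_lsc hcase hx₀
  have hex := EVIFlow.exists_gradientCurve hφ_bot hx₀ hC hB hevi hlow hδ hmin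
  -- The chosen curve is the same for all `t`, so the default value in `gradientFlow` plays no role.
  have hflow : (fun t => EVIFlow.gradientFlow φ t x₀) = hex.choose := by
    funext t
    rw [EVIFlow.gradientFlow, dif_pos hex]
  have hgrad : EVIFlow.IsGradientCurve φ x₀ (fun t => EVIFlow.gradientFlow φ t x₀) :=
    hflow ▸ hex.choose_spec
  obtain ⟨P, x, h, ha⟩ := hgrad.exists_approximation
  exact ⟨hgrad, fun t ht => ha.mem_domain hφ_bot hφ_lsc hx₀ ht,
    fun y hy t ht => ha.limsup_evi hφ_bot hφ_lsc hx₀ hC hB hevi hlow hy ht.le,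
    fun y hy => ha.ae_evi hφ_bot hφ_lsc hx₀ hC hB hevi hlow hy⟩
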